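/- Let $K:\mathbb{R}^n\setminus\{0\}\to\mathbb{R}$ be a kernel with $K\ge 0$, $K(-z)=K(z)$, $\int_{\mathbb{R}^n}K(z)\min\{1,|z|\}\,dz<\infty$ and $K\ge 1$ in $B_2\setminus\{0\}$. Suppose that the directional derivatives $\partial_eK$ and $\partial_{ee}K$ exist in $\mathbb{R}^n\setminus\{0\}$ for every unit vector $e$ and that, for some function $K^*$, $$\max\Bigl\{|z|\,|\partial_eK(z)|,\ |z|^2\sup_{|y-z|\le|z|/2}|\partial_{ee}K(y)|\Bigr\}\le K^*(z)\qquad\text{for all } z\ne0,\ |e|=1 .$$ Assume that one of the following holds: 1. $n=2$ and $K^*\in L^1(\mathbb{R}^2)$; 2. $n\in\{2,3\}$, $K$ has compact support, and $K^*$ is of one of the following three kinds: $K^*=C_1K$ for some constant $C_1$; $K^*=C_1(K+\chi_{\{|z|<R_0\}})$ for some constants $C_1$ and $R_0\ge2$; or $K^*\in L^1(\mathbb{R}^n)$. For measurable sets put $L_K(A,B)=\int_A\int_BK(x-y)\,dy\,dx$, write $\mathcal{C}E=\mathbb{R}^n\setminus E$, and for $\Omega$ open and bounded let $$P_{K,\Omega}(E)=L_K(E\cap\Omega,\mathcal{C}E\cap\Omega)+L_K(E\cap\Omega,\mathcal{C}E\setminus\Omega)+L_K(E\setminus\Omega,\mathcal{C}E\cap\Omega).$$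 A measurable set $E$ is a minimizer of the $K$-perimeter in $\Omega$ if $P_{K,\Omega}(E)<\infty$ and $P_{K,\Omega}(E)\le P_{K,\Omega}(F)$ for every measurable $F$ with $F\setminus\Omega=E\setminus\Omega$; it is a minimizer in every compact set of $\mathbb{R}^n$ if this holds for every bounded open $\Omega\subset\mathbb{R}^n$. Then half-spaces are the only nontrivial minimizers in every compact set of $\mathbb{R}^n$: a measurable set $E\subset\mathbb{R}^n$ with $|E|>0$ and $|\mathcal{C}E|>0$ is a minimizer of the $K$-perimeter in every compact set of $\mathbb{R}^n$ if and only if, up to a set of Lebesgue measure zero, $E=\{x: e\cdot x\le c\}$ for some unit vector $e$ and some $c\in\mathbb{R}$. -/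

import Mathlib

open MeasureTheory
open scoped ENNReal

/-- `ℝⁿ` with its Euclidean norm. -/
abbrev Rn (n : ℕ) : Type := EuclideanSpace ℝ (Fin n)

/-- The interaction `L_K(A, B) = ∫_A ∫_B K(x - y) dy dx ∈ [0, ∞]`. For the nonnegative kernels
considered here `ENNReal.ofReal` changes nothing (the value at the origin is irrelevant). -/
noncomputable def interaction {n : ℕ} (K : Rn n → ℝ) (A B : Set (Rn n)) : ℝ≥0∞ :=
  ∫⁻ x in A, ∫⁻ y in B, ENNReal.ofReal (K (x - y))

/-- The `K`-perimeter of `E` inside `Ω`. -/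
noncomputable def kPerimeter {n : ℕ} (K : Rn n → ℝ) (Ω E : Set (Rn n)) : ℝ≥0∞ :=
  interaction K (E ∩ Ω) (Eᶜ ∩ Ω) + interaction K (E ∩ Ω) (Eᶜ \ Ω)
    + interaction K (E \ Ω) (Eᶜ ∩ Ω)

/-- `E` is a minimizer of the `K`-perimeter in `Ω`: its `K`-perimeter inside `Ω` is finite and not
larger than that of any (Lebesgue) measurable set which coincides with `E` outside `Ω`. -/
def IsKMinimizer {n : ℕ} (K : Rn n → ℝ) (Ω E : Set (Rn n)) : Prop :=
  kPerimeter K Ω E < ∞ ∧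
    ∀ F : Set (Rn n), NullMeasurableSet F volume → F \ Ω = E \ Ω →
      kPerimeter K Ω E ≤ kPerimeter K Ω F

/-- `E` is a minimizer of the `K`-perimeter in every compact set of `ℝⁿ`, i.e. in every bounded
open set. -/
def IsKMinimizerInCompacts {n : ℕ} (K : Rn n → ℝ) (E : Set (Rn n)) : Prop :=
  ∀ Ω : Set (Rn n), IsOpen Ω → Bornology.IsBounded Ω → IsKMinimizer K Ω E

/-- The basic assumptions on the kernel. A kernel is a function on `ℝⁿ ∖ {0}`, possibly singular at
the origin, so nothing is asked of the value that the Lean function takes at `0`. -/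
structure IsKernel {n : ℕ} (K : Rn n → ℝ) : Prop where
  nonneg : ∀ z, z ≠ 0 → 0 ≤ K z
  even : ∀ z, K (-z) = K z
  integrable : Integrable (fun z => K z * min 1 ‖z‖) volume
  one_le : ∀ z, z ≠ 0 → ‖z‖ < 2 → 1 ≤ K z

/-- The second directional derivative `∂_{ee} K (y)`. -/
noncomputable def lineDeriv₂ {n : ℕ} (K : Rn n → ℝ) (y e : Rn n) : ℝ :=
  lineDeriv ℝ (fun x => lineDeriv ℝ K x e) y e

/-- The derivatives `∂_e K` and `∂_{ee} K` exist away from the origin, for every unit vector `e`,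
and `max { |z| |∂_e K(z)|, |z|² sup_{|y - z| ≤ |z|/2} |∂_{ee} K(y)| } ≤ K*(z)` for all `z ≠ 0`. -/
structure DerivBound {n : ℕ} (K Kstar : Rn n → ℝ) : Prop where
  diff : ∀ e : Rn n, ‖e‖ = 1 → ∀ z, z ≠ 0 → LineDifferentiableAt ℝ K z e
  diff₂ : ∀ e : Rn n, ‖e‖ = 1 → ∀ z, z ≠ 0 →
    LineDifferentiableAt ℝ (fun x => lineDeriv ℝ K x e) z e
  bound : ∀ e : Rn n, ‖e‖ = 1 → ∀ z, z ≠ 0 → ‖z‖ * |lineDeriv ℝ K z e| ≤ Kstar z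
  bound₂ : ∀ e : Rn n, ‖e‖ = 1 → ∀ z, z ≠ 0 → ∀ y, ‖y - z‖ ≤ ‖z‖ / 2 →
    ‖z‖ ^ 2 * |lineDeriv₂ K y e| ≤ Kstar z

/-- The three standing alternatives for the dominating kernel `K*`: `K* = C₁ K`, or
`K* = C₁ (K + χ_{|z| < R₀})` with `R₀ ≥ 2`, or `K* ∈ L¹(ℝⁿ)`. -/
def StandingCases {n : ℕ} (K Kstar : Rn n → ℝ) : Prop :=
  (∃ C₁ : ℝ, ∀ z, z ≠ 0 → Kstar z = C₁ * K z) ∨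
  (∃ C₁ R₀ : ℝ, 2 ≤ R₀ ∧ ∀ z, z ≠ 0 →
    Kstar z = C₁ * (K z + (Metric.ball (0 : Rn n) R₀).indicator (fun _ => (1 : ℝ)) z)) ∨
  Integrable Kstar volume

/-- Half-spaces of `ℝⁿ`. -/
def IsHalfSpace {n : ℕ} (H : Set (Rn n)) : Prop :=
  ∃ (e : Rn n) (c : ℝ), ‖e‖ = 1 ∧ H = {x | inner ℝ e x ≤ c}

/-! ### Taylor estimates for the kernel -/

/-! For the rigidity direction, a minimizer `E` is moved by the two opposite shears `x ↦ x ± φ(x)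
h`, giving sets `A` and `B`. Averaging over the two signs cancels the first variation, so the
perimeters of `A` and `B` add up to at most twice that of `E` plus a term quadratic in the
deformation (`DerivBound.second_variation`). Submodularity has a quantitative gain: replacing `A`,
`B` by `A ∪ B`, `A ∩ B` saves the interaction of `A \ B` with `B \ A`. Since the union and
intersection are admissible competitors, that interaction is at most the quadratic error
(`IsKMinimizer.setLIntegral_shear_le`).

The error is made arbitrarily small by a logarithmic cutoff. If the energy of `E` for a kernel
dominating `K + K*` grows at most like `R²`, each of `N` dyadic scales costs a bounded amount,
weighted by `N⁻²`, so the error is `O(1/N)`. Quadratic growth is where the dimension enters: in the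
plane it follows from integrability and the area of a disc; for compactly supported kernels,
comparison with `E \ B_R` gives `R^(n-1)`, enough for `n ≤ 3`.

In the limit, nearby points cannot cross in opposite senses between the translates `E + h` and `E -
h`, because `K ≥ 1` near the origin (`volume_crossing_eq_zero`). A Fubini argument then makes `E`
comparable, up to null sets, with every translate of itself. The vectors `d` with `E + d ⊆ E` form a
closed convex cone which together with its opposite fills the space; Hahn-Banach shows that it
contains a closed half-space of directions, and `E` is a half-space.

Conversely, half-spaces are calibrated: for an integrable kernel restricted to the decreasing
directions of `⟨e, ·⟩`, a signed count of pairs depends only on the set outside `Ω`. It bounds the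
perimeter of every competitor from below and is attained by the half-space. Truncation near the
origin and monotone convergence handle singular kernels. -/

theorem LineDifferentiableAt.hasDerivAt_line {n : ℕ} {f : Rn n → ℝ} {z e : Rn n} {s : ℝ}
    (h : LineDifferentiableAt ℝ f (z + s • e) e) :
    HasDerivAt (fun s : ℝ => f (z + s • e)) (lineDeriv ℝ f (z + s • e) e) s := by
  have h1 : HasDerivAt (fun t : ℝ => f (z + s • e + t • e)) (lineDeriv ℝ f (z + s • e) e) (s - s) := by
    rw [sub_self]; exact h.hasLineDerivAt
  have h2 := HasDerivAt.comp_sub_const s s h1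
  refine h2.congr_of_eventuallyEq (Filter.Eventually.of_forall fun t => ?_)
  simp only [add_assoc, ← add_smul]
  congr 3; ring

theorem add_smul_ne_zero_of_le_half {n : ℕ} {z w : Rn n} (hz : z ≠ 0) (hw : ‖w‖ ≤ ‖z‖ / 2) :
    z + w ≠ 0 := by
  intro h
  have h1 : ‖z‖ = ‖w‖ := by rw [eq_neg_of_add_eq_zero_left h, norm_neg]
  have := norm_pos_iff.mpr hz
  linarith

theorem sub_zero_bound_of_hasDerivAt {f f' : ℝ → ℝ} {C s : ℝ}
    (hf : ∀ t, |t| ≤ |s| → HasDerivAt f (f' t) t) (hb : ∀ t, |t| ≤ |s| → |f' t| ≤ C) :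
    |f s - f 0| ≤ C * |s| := by
  have hconv : Convex ℝ {t : ℝ | |t| ≤ |s|} := by
    have : {t : ℝ | |t| ≤ |s|} = Set.Icc (-|s|) |s| := by ext t; simp [abs_le]
    rw [this]; exact convex_Icc _ _
  have := hconv.norm_image_sub_le_of_norm_hasDerivWithin_le (f := f) (f' := f') (C := C)
    (x := 0) (y := s) (fun t ht => (hf t ht).hasDerivWithinAt) (fun t ht => hb t ht)
    (show |(0 : ℝ)| ≤ |s| by rw [abs_zero]; exact abs_nonneg s) (show |s| ≤ |s| from le_rfl)
  simpa using this

namespace DerivBound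

variable {n : ℕ} {K Kstar : Rn n → ℝ}

theorem nonneg (hD : DerivBound K Kstar) {z : Rn n} (hz : z ≠ 0) : 0 ≤ Kstar z := by
  have h := hD.bound (‖z‖⁻¹ • z) (norm_smul_inv_norm (𝕜 := ℝ) hz) z hz
  exact le_trans (by positivity) h

theorem taylor (hD : DerivBound K Kstar) {z e : Rn n} (hz : z ≠ 0) (he : ‖e‖ = 1) {s : ℝ}
    (hs : |s| ≤ ‖z‖ / 2) :
    |K (z + s • e) - K z - s * lineDeriv ℝ K z e| ≤ Kstar z / ‖z‖ ^ 2 * s ^ 2 := by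
  have hzp : 0 < ‖z‖ := norm_pos_iff.mpr hz
  have hne : ∀ t : ℝ, |t| ≤ |s| → z + t • e ≠ 0 := fun t ht =>
    add_smul_ne_zero_of_le_half hz (by rw [norm_smul, he, mul_one]; exact ht.trans hs)
  have h1 : ∀ t : ℝ, |t| ≤ |s| →
      |lineDeriv ℝ K (z + t • e) e - lineDeriv ℝ K z e| ≤ Kstar z / ‖z‖ ^ 2 * |s| := by
    intro t ht
    have := sub_zero_bound_of_hasDerivAt (f := fun t => lineDeriv ℝ K (z + t • e) e)
      (f' := fun t => lineDeriv₂ K (z + t • e) e) (C := Kstar z / ‖z‖ ^ 2) (s := t)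
      (fun u hu => (hD.diff₂ e he _ (hne u (hu.trans ht))).hasDerivAt_line)
      -- The whole segment from `z` lies in the ball of radius `‖z‖ / 2`, where the single number
      -- `Kstar z` controls second derivatives.
      (fun u hu => by
        rw [le_div_iff₀ (by positivity), mul_comm]
        refine hD.bound₂ e he z hz _ ?_
        rw [add_sub_cancel_left, norm_smul, he, mul_one]
        exact (hu.trans ht).trans hs)
    simp only [zero_smul, add_zero] at this
    refine this.trans ?_
    gcongr
    exact div_nonneg (hD.nonneg hz) (by positivity)
  have h2 := sub_zero_bound_of_hasDerivAt
    (f := fun t => K (z + t • e) - t * lineDeriv ℝ K z e)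
    (f' := fun t => lineDeriv ℝ K (z + t • e) e - lineDeriv ℝ K z e)
    (C := Kstar z / ‖z‖ ^ 2 * |s|) (s := s)
    (fun t ht => by
      have h := (hD.diff e he _ (hne t ht)).hasDerivAt_line.sub
        ((hasDerivAt_id t).mul_const (lineDeriv ℝ K z e))
      rw [one_mul] at h
      exact h)
    h1
  simp only [zero_smul, add_zero, zero_mul, sub_zero] at h2
  have h3 : Kstar z / ‖z‖ ^ 2 * |s| * |s| = Kstar z / ‖z‖ ^ 2 * s ^ 2 := by
    rw [mul_assoc, ← sq, sq_abs]
  rw [h3] at h2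
  convert h2 using 2
  ring

/-- First and second differences of the kernel at `z`, for increments `w` with `‖w‖ = r ‖z‖`. -/
theorem differences (hD : DerivBound K Kstar) {z w : Rn n} (hz : z ≠ 0) {r : ℝ}
    (hr : ‖w‖ = r * ‖z‖) (hr' : r ≤ 1 / 2) :
    |K (z + w) - K z| ≤ 2 * r * Kstar z ∧
    K (z + w) + K (z - w) ≤ 2 * K z + 2 * r ^ 2 * Kstar z ∧
    |K (z + w) - K (z - w)| ≤ 3 * r * Kstar z := by
  have hzp : 0 < ‖z‖ := norm_pos_iff.mpr hz
  have hr0 : 0 ≤ r := by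
    by_contra h
    have : r * ‖z‖ < 0 := mul_neg_of_neg_of_pos (not_le.mp h) hzp
    linarith [norm_nonneg w]
  have hS := hD.nonneg hz
  obtain ⟨e, he, hw⟩ : ∃ e : Rn n, ‖e‖ = 1 ∧ w = ‖w‖ • e := by
    by_cases h0 : w = 0
    · exact ⟨‖z‖⁻¹ • z, norm_smul_inv_norm (𝕜 := ℝ) hz, by simp [h0]⟩
    · refine ⟨‖w‖⁻¹ • w, norm_smul_inv_norm (𝕜 := ℝ) h0, ?_⟩
      rw [smul_smul, mul_inv_cancel₀ (norm_ne_zero_iff.mpr h0), one_smul]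
  have hs : |‖w‖| ≤ ‖z‖ / 2 := by
    rw [abs_norm, hr]; nlinarith
  have hp := hD.taylor hz he hs
  have hm := hD.taylor hz he (s := -‖w‖) (by rwa [abs_neg])
  rw [neg_smul, ← hw, ← sub_eq_add_neg] at hm
  rw [← hw] at hp
  have hb := hD.bound e he z hz
  have hQ : Kstar z / ‖z‖ ^ 2 * ‖w‖ ^ 2 = r ^ 2 * Kstar z := by
    rw [hr]; field_simp
  rw [neg_sq, hQ] at hm
  rw [hQ] at hp
  have hd : |‖w‖ * lineDeriv ℝ K z e| ≤ r * Kstar z := by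
    rw [abs_mul, abs_norm, hr, mul_assoc]
    exact mul_le_mul_of_nonneg_left hb hr0
  -- As `r ≤ 1/2`, the quadratic Taylor remainder is absorbed into the linear bounds, which is how
  -- the factors 2 and 3 arise.
  have hrr : r ^ 2 * Kstar z ≤ 1 / 2 * (r * Kstar z) := by
    have : r * (r * Kstar z) ≤ 1 / 2 * (r * Kstar z) :=
      mul_le_mul_of_nonneg_right hr' (by positivity)
    nlinarith
  have hrn : 0 ≤ r * Kstar z := by positivity
  rw [abs_le] at hp hm hd
  refine ⟨?_, ?_, ?_⟩
  · rw [abs_le]; constructor <;> linarith [hp.1, hp.2, hd.1, hd.2]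
  · linarith [hp.1, hp.2, hm.1, hm.2]
  · rw [abs_le]; constructor <;> linarith [hp.1, hp.2, hd.1, hd.2, hm.1, hm.2]

/-- Existence of all directional derivatives would not suffice; the first-difference bound is
uniform over directions at a fixed `z`, and this gives continuity. -/
theorem continuousAt (hD : DerivBound K Kstar) {z : Rn n} (hz : z ≠ 0) : ContinuousAt K z := by
  have hzp : 0 < ‖z‖ := norm_pos_iff.mpr hz
  have hlim : Filter.Tendsto (fun y => 2 * (‖y - z‖ / ‖z‖) * Kstar z) (nhds z) (nhds 0) := by
    have : Continuous (fun y : Rn n => 2 * (‖y - z‖ / ‖z‖) * Kstar z) := by fun_prop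
    simpa using this.tendsto z
  rw [ContinuousAt, tendsto_iff_norm_sub_tendsto_zero]
  refine squeeze_zero' (Filter.Eventually.of_forall fun _ => norm_nonneg _) ?_ hlim
  filter_upwards [Metric.closedBall_mem_nhds z (half_pos hzp)] with y hy
  rw [Metric.mem_closedBall, dist_eq_norm] at hy
  have := (hD.differences (w := y - z) hz (r := ‖y - z‖ / ‖z‖) (by field_simp)
    (by rw [div_le_iff₀ hzp]; linarith)).1
  simpa using this

theorem measurable (hD : DerivBound K Kstar) : Measurable K :=
  measurable_of_continuousOn_compl_singleton 0 fun _ hz => (hD.continuousAt hz).continuousWithinAt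

/-- Here `a`, `b` stand for the derivatives of `φ` along `h` at two points, so the products are
Jacobians. Splitting into even and odd parts pairs the second difference of `K` with `1 + ab`, and
the first difference, of order `r`, with `a + b`: no linear term survives. The constant 7 is `4 +
3`, the coefficient of `r² K*` from the even and odd parts. -/
theorem second_variation (hD : DerivBound K Kstar) (hK : ∀ z, z ≠ 0 → 0 ≤ K z) {z w : Rn n}
    (hz : z ≠ 0) (hw : ‖w‖ ≤ ‖z‖ / 2) {a b : ℝ} (ha : |a| ≤ 1) (hb : |b| ≤ 1) :
    K (z + w) * ((1 + a) * (1 + b)) + K (z - w) * ((1 - a) * (1 - b)) ≤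
      2 * K z + 7 * (a ^ 2 + b ^ 2 + (‖w‖ / ‖z‖) ^ 2) * (K z + Kstar z) := by
  have hzp : 0 < ‖z‖ := norm_pos_iff.mpr hz
  set r := ‖w‖ / ‖z‖ with hr
  have hr0 : 0 ≤ r := by positivity
  obtain ⟨-, h1, h2⟩ := hD.differences (w := w) hz (r := r) (by rw [hr]; field_simp)
    (by rw [hr, div_le_iff₀ hzp]; linarith)
  have hS := hD.nonneg hz
  have hK0 := hK z hz
  have hab : |a * b| ≤ 1 := by
    rw [abs_mul]; exact mul_le_one₀ ha (abs_nonneg _) hb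
  have hab' := abs_le.mp hab
  have e1 : K (z + w) * ((1 + a) * (1 + b)) + K (z - w) * ((1 - a) * (1 - b)) =
      (1 + a * b) * (K (z + w) + K (z - w)) + (a + b) * (K (z + w) - K (z - w)) := by ring
  have e2 : (1 + a * b) * (K (z + w) + K (z - w)) ≤
      (1 + a * b) * (2 * K z + 2 * r ^ 2 * Kstar z) :=
    mul_le_mul_of_nonneg_left h1 (by linarith)
  have e3 : (a + b) * (K (z + w) - K (z - w)) ≤ |a + b| * (3 * r * Kstar z) :=
    (le_abs_self _).trans (by
      rw [abs_mul]; exact mul_le_mul_of_nonneg_left h2 (abs_nonneg _))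
  have e4 : a * b * (2 * K z) ≤ (a ^ 2 + b ^ 2) * K z := by
    nlinarith [mul_nonneg (sq_nonneg (a - b)) hK0]
  have e5 : (1 + a * b) * (2 * r ^ 2 * Kstar z) ≤ 4 * r ^ 2 * Kstar z := by
    have : 0 ≤ 2 * r ^ 2 * Kstar z := by positivity
    nlinarith [mul_nonneg (by linarith : 0 ≤ 1 - a * b) this]
  have e6 : |a + b| * (3 * r) ≤ 3 * (a ^ 2 + b ^ 2) + 3 * r ^ 2 := by
    have h3 : |a + b| * r * 2 ≤ |a + b| ^ 2 + r ^ 2 := by nlinarith [sq_nonneg (|a + b| - r)]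
    rw [sq_abs] at h3
    nlinarith [sq_nonneg (a - b), sq_nonneg r]
  have e7 : |a + b| * (3 * r * Kstar z) ≤ (3 * (a ^ 2 + b ^ 2) + 3 * r ^ 2) * Kstar z := by
    rw [← mul_assoc]; exact mul_le_mul_of_nonneg_right e6 hS
  have p1 : 0 ≤ (a ^ 2 + b ^ 2) * Kstar z := by positivity
  have p2 : 0 ≤ (a ^ 2 + b ^ 2) * K z := by positivity
  have p3 : 0 ≤ r ^ 2 * K z := by positivity
  have p4 : 0 ≤ r ^ 2 * Kstar z := by positivity
  rw [e1]
  nlinarith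

end DerivBound

/-! ### The perimeter as an integral over a set of pairs -/

/-- The pairs of points separated by `E`, not both outside `Ω`. -/
def cut {X : Type*} (Ω E : Set X) : Set (X × X) :=
  {p | p.1 ∈ E ∧ p.2 ∉ E ∧ (p.1 ∈ Ω ∨ p.2 ∈ Ω)}

theorem measurableSet_cut {X : Type*} [MeasurableSpace X] {Ω E : Set X} (hΩ : MeasurableSet Ω)
    (hE : MeasurableSet E) : MeasurableSet (cut Ω E) :=
  (measurable_fst hE).inter ((measurable_snd hE).compl.inter
    ((measurable_fst hΩ).union (measurable_snd hΩ)))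

/-- Submodularity pair by pair: a pair cut by the union or the intersection is cut by `A` or `B`,
and one cut by both is cut by both `A` and `B`. Pairs from `A \ B` to `B \ A` are cut by `A` but by
neither the union nor the intersection, hence the gain. -/
theorem measure_cut_union_add_inter_le {X : Type*} [MeasurableSpace X] (μ : Measure (X × X))
    {Ω A B : Set X} (hΩ : MeasurableSet Ω) (hA : MeasurableSet A) (hB : MeasurableSet B) :
    μ (cut Ω (A ∪ B)) + μ (cut Ω (A ∩ B)) +
      μ (((A \ B) ×ˢ (B \ A)) ∩ {p | p.1 ∈ Ω ∨ p.2 ∈ Ω}) ≤ μ (cut Ω A) + μ (cut Ω B) := by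
  set T := ((A \ B) ×ˢ (B \ A)) ∩ {p : X × X | p.1 ∈ Ω ∨ p.2 ∈ Ω} with hT
  have hTm : MeasurableSet T := ((hA.diff hB).prod (hB.diff hA)).inter
    ((measurable_fst hΩ).union (measurable_snd hΩ))
  have hI := measurableSet_cut hΩ (hA.inter hB)
  rw [← measure_union_add_inter (cut Ω A) (measurableSet_cut hΩ hB),
    ← measure_union_add_inter (cut Ω (A ∪ B)) hI]
  have h1 : Disjoint (cut Ω (A ∪ B) ∪ cut Ω (A ∩ B)) T := by
    rw [Set.disjoint_left]
    rintro p hp ⟨⟨hp1, hp2⟩, -⟩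
    simp only [cut, Set.mem_union, Set.mem_ofPred_eq, Set.mem_inter_iff, Set.mem_sdiff] at *
    tauto
  have h2 : (cut Ω (A ∪ B) ∪ cut Ω (A ∩ B)) ∪ T ⊆ cut Ω A ∪ cut Ω B := by
    intro p hp
    simp only [hT, cut, Set.mem_union, Set.mem_ofPred_eq, Set.mem_inter_iff, Set.mem_sdiff,
      Set.mem_prod] at *
    tauto
  have h3 : cut Ω (A ∪ B) ∩ cut Ω (A ∩ B) ⊆ cut Ω A ∩ cut Ω B := by
    intro p hp
    simp only [cut, Set.mem_union, Set.mem_ofPred_eq, Set.mem_inter_iff] at *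
    tauto
  calc _ = μ ((cut Ω (A ∪ B) ∪ cut Ω (A ∩ B)) ∪ T) + μ (cut Ω (A ∪ B) ∩ cut Ω (A ∩ B)) := by
        rw [measure_union h1 hTm]; ring
    _ ≤ _ := add_le_add (measure_mono h2) (measure_mono h3)

theorem setLIntegral_cut_union_add_inter_le {X : Type*} [MeasurableSpace X] (μ : Measure (X × X))
    [SFinite μ] (f : X × X → ℝ≥0∞)
    {Ω A B : Set X} (hΩ : MeasurableSet Ω) (hA : MeasurableSet A) (hB : MeasurableSet B) :
    ∫⁻ p in cut Ω (A ∪ B), f p ∂μ + ∫⁻ p in cut Ω (A ∩ B), f p ∂μ +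
      ∫⁻ p in ((A \ B) ×ˢ (B \ A)) ∩ {p | p.1 ∈ Ω ∨ p.2 ∈ Ω}, f p ∂μ ≤
      ∫⁻ p in cut Ω A, f p ∂μ + ∫⁻ p in cut Ω B, f p ∂μ := by
  have := measure_cut_union_add_inter_le (μ.withDensity f) hΩ hA hB
  simpa only [withDensity_apply'] using this

section

variable {n : ℕ} {K : Rn n → ℝ}

theorem interaction_eq (hK : Measurable K) (A B : Set (Rn n)) :
    interaction K A B = ∫⁻ p in A ×ˢ B, ENNReal.ofReal (K (p.1 - p.2)) := by
  have hf : Measurable fun p : Rn n × Rn n => ENNReal.ofReal (K (p.1 - p.2)) :=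
    (hK.comp (measurable_fst.sub measurable_snd)).ennreal_ofReal
  rw [Measure.volume_eq_prod, ← Measure.prod_restrict, lintegral_prod _ hf.aemeasurable]
  rfl

theorem kPerimeter_eq (hK : Measurable K) {Ω E : Set (Rn n)} (hΩ : MeasurableSet Ω)
    (hE : MeasurableSet E) :
    kPerimeter K Ω E = ∫⁻ p in cut Ω E, ENNReal.ofReal (K (p.1 - p.2)) := by
  have hd1 : Disjoint ((E ∩ Ω) ×ˢ (Eᶜ ∩ Ω)) ((E ∩ Ω) ×ˢ (Eᶜ \ Ω)) := by
    rw [Set.disjoint_left]; rintro p ⟨-, -, h⟩ ⟨-, -, h'⟩; exact h' h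
  have hd2 : Disjoint ((E ∩ Ω) ×ˢ (Eᶜ ∩ Ω) ∪ (E ∩ Ω) ×ˢ (Eᶜ \ Ω)) ((E \ Ω) ×ˢ (Eᶜ ∩ Ω)) := by
    rw [Set.disjoint_left]
    rintro p (⟨⟨-, h⟩, -⟩ | ⟨⟨-, h⟩, -⟩) ⟨⟨-, h'⟩, -⟩ <;> exact h' h
  have hu : cut Ω E = ((E ∩ Ω) ×ˢ (Eᶜ ∩ Ω) ∪ (E ∩ Ω) ×ˢ (Eᶜ \ Ω)) ∪ ((E \ Ω) ×ˢ (Eᶜ ∩ Ω)) := by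
    ext p
    simp only [cut, Set.mem_union, Set.mem_ofPred_eq, Set.mem_inter_iff, Set.mem_sdiff,
      Set.mem_prod, Set.mem_compl_iff]
    tauto
  rw [kPerimeter, interaction_eq hK, interaction_eq hK, interaction_eq hK, hu,
    lintegral_union ((hE.diff hΩ).prod (hE.compl.inter hΩ)) hd2,
    lintegral_union ((hE.inter hΩ).prod (hE.compl.diff hΩ)) hd1]

theorem interaction_congr {A A' B B' : Set (Rn n)} (hA : A =ᵐ[volume] A') (hB : B =ᵐ[volume] B') :
    interaction K A B = interaction K A' B' := by
  unfold interaction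
  rw [setLIntegral_congr hA]
  simp_rw [setLIntegral_congr hB]

theorem kPerimeter_congr {Ω E F : Set (Rn n)} (h : E =ᵐ[volume] F) :
    kPerimeter K Ω E = kPerimeter K Ω F := by
  unfold kPerimeter
  have hr : Ω =ᵐ[volume] Ω := Filter.EventuallyEq.rfl
  rw [interaction_congr (h.inter hr) (h.compl.inter hr),
    interaction_congr (h.inter hr) (h.compl.diff hr),
    interaction_congr (h.diff hr) (h.compl.inter hr)]

/-- The definition asks for exact agreement outside `Ω`. A competitor agreeing only almost
everywhere is corrected there on a null set, without changing its perimeter. -/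
theorem IsKMinimizer.le_of_ae {Ω E F : Set (Rn n)} (h : IsKMinimizer K Ω E)
    (hΩ : MeasurableSet Ω) (hE : NullMeasurableSet E volume) (hF : NullMeasurableSet F volume)
    (hFE : ∀ᵐ x ∂volume, x ∉ Ω → (x ∈ F ↔ x ∈ E)) : kPerimeter K Ω E ≤ kPerimeter K Ω F := by
  have h1 := h.2 ((F ∩ Ω) ∪ (E \ Ω))
    ((hF.inter hΩ.nullMeasurableSet).union (hE.diff hΩ.nullMeasurableSet)) (by
      ext x
      simp only [Set.mem_union, Set.mem_inter_iff, Set.mem_sdiff]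
      tauto)
  refine h1.trans (kPerimeter_congr ?_).le
  filter_upwards [hFE] with x hx
  apply propext
  change (x ∈ F ∧ x ∈ Ω) ∨ (x ∈ E ∧ x ∉ Ω) ↔ x ∈ F
  by_cases hxΩ : x ∈ Ω <;> simp [hxΩ]
  exact (hx hxΩ).symm

theorem IsKMinimizer.congr {Ω E E' : Set (Rn n)} (h : IsKMinimizer K Ω E)
    (hΩ : MeasurableSet Ω) (hE : NullMeasurableSet E volume) (hEE' : E =ᵐ[volume] E') :
    IsKMinimizer K Ω E' := by
  refine ⟨by rw [← kPerimeter_congr hEE']; exact h.1, fun F hF hFE => ?_⟩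
  rw [← kPerimeter_congr hEE']
  refine h.le_of_ae hΩ hE hF ?_
  filter_upwards [hEE'] with x hx hxΩ
  have hx' : x ∈ E ↔ x ∈ E' := Iff.of_eq hx
  have h3 : x ∈ F \ Ω ↔ x ∈ E' \ Ω := by rw [hFE]
  simp only [Set.mem_sdiff, hxΩ, not_false_eq_true, and_true] at h3
  rw [hx', h3]

end

/-! ### Deformations along a fixed direction -/

/-- The map `x ↦ x + φ(x) h`. -/
def shear {n : ℕ} (φ : Rn n → ℝ) (h : Rn n) (x : Rn n) : Rn n := x + φ x • h

section

variable {n : ℕ} {φ : Rn n → ℝ} {h : Rn n}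

/-- The shear is the identity plus a map with Lipschitz constant at most `1/2`, hence invertible by
the quantitative inverse function theorem. -/
theorem exists_homeomorph_shear {L : NNReal} (hφ : LipschitzWith L φ) (hL : L * ‖h‖ ≤ 1 / 2) :
    ∃ Ψ : Rn n ≃ₜ Rn n, ∀ x, Ψ x = shear φ h x := by
  have happ : ApproximatesLinearOn (shear φ h)
      ((ContinuousLinearEquiv.refl ℝ (Rn n) : Rn n ≃L[ℝ] Rn n) : Rn n →L[ℝ] Rn n)
      Set.univ (1 / 2 : NNReal) := by
    intro x _ y _
    have e : shear φ h x - shear φ h y -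
        ((ContinuousLinearEquiv.refl ℝ (Rn n) : Rn n ≃L[ℝ] Rn n) : Rn n →L[ℝ] Rn n) (x - y) =
        (φ x - φ y) • h := by
      simp [shear, sub_smul]; abel
    rw [e, norm_smul]
    have h1 := hφ.dist_le_mul x y
    rw [dist_eq_norm, dist_eq_norm] at h1
    calc ‖φ x - φ y‖ * ‖h‖ ≤ L * ‖x - y‖ * ‖h‖ := by gcongr
      _ = L * ‖h‖ * ‖x - y‖ := by ring
      _ ≤ _ := by
        have : ((1 / 2 : NNReal) : ℝ) = 1 / 2 := by norm_num
        rw [this]; gcongr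
  refine ⟨happ.toHomeomorph _ ?_, fun x => rfl⟩
  rcases subsingleton_or_nontrivial (Rn n) with hs | hs
  · exact Or.inl hs
  · right
    have : ‖((ContinuousLinearEquiv.refl ℝ (Rn n)).symm : Rn n →L[ℝ] Rn n)‖₊ = 1 := by
      ext; exact ContinuousLinearMap.norm_id
    rw [this, inv_one]
    exact NNReal.half_lt_self one_ne_zero

theorem hasFDerivAt_shear (hφ : Differentiable ℝ φ) (x : Rn n) :
    HasFDerivAt (shear φ h) (ContinuousLinearMap.id ℝ (Rn n) + (fderiv ℝ φ x).smulRight h) x :=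
  (hasFDerivAt_id x).add ((hφ x).hasFDerivAt.smul_const h)

theorem det_id_add_smulRight (f : Rn n →L[ℝ] ℝ) (h : Rn n) :
    (ContinuousLinearMap.id ℝ (Rn n) + f.smulRight h).det = 1 + f h := by
  have : ((ContinuousLinearMap.id ℝ (Rn n) + f.smulRight h : Rn n →L[ℝ] Rn n) :
      Rn n →ₗ[ℝ] Rn n) = LinearMap.transvection (f : Rn n →ₗ[ℝ] ℝ) h := by
    ext x; simp [LinearMap.transvection]
  rw [ContinuousLinearMap.det, this, LinearMap.transvection.det]
  rfl

theorem abs_fderiv_apply_le_half {L : NNReal} (hφ : LipschitzWith L φ) (hL : L * ‖h‖ ≤ 1 / 2)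
    (x : Rn n) : |fderiv ℝ φ x h| ≤ 1 / 2 :=
  ((fderiv ℝ φ x).le_opNorm h).trans ((mul_le_mul_of_nonneg_right
    (norm_fderiv_le_of_lipschitz ℝ hφ) (norm_nonneg h)).trans hL)

/-- The derivative is a rank-one perturbation of the identity, with determinant exactly `1 + ∂_h φ`.
This is at least `1/2`, so the absolute value in the change of variables disappears. -/
theorem measurePreserving_shear {L : NNReal} (hφ : LipschitzWith L φ) (hL : L * ‖h‖ ≤ 1 / 2)
    (hd : Differentiable ℝ φ) :
    MeasurePreserving (shear φ h)
      (volume.withDensity fun x => ENNReal.ofReal (1 + fderiv ℝ φ x h)) volume := by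
  obtain ⟨Ψ, hΨ⟩ := exists_homeomorph_shear hφ hL
  have hΨ' : shear φ h = Ψ := funext fun x => (hΨ x).symm
  have hm := map_withDensity_abs_det_fderiv_eq_addHaar (volume : Measure (Rn n))
    (s := Set.univ) (f := shear φ h)
    (f' := fun x => ContinuousLinearMap.id ℝ (Rn n) + (fderiv ℝ φ x).smulRight h)
    MeasurableSet.univ.nullMeasurableSet (fun x _ => (hasFDerivAt_shear hd x).hasFDerivWithinAt)
    (by rw [hΨ']; exact Ψ.injective.injOn)
  rw [Set.image_univ, hΨ', Ψ.surjective.range_eq, Measure.restrict_univ, ← hΨ'] at hm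
  refine ⟨by rw [hΨ']; exact Ψ.continuous.measurable, ?_⟩
  convert! hm using 5 with x
  rw [det_id_add_smulRight, abs_of_nonneg]
  have := abs_le.mp (abs_fderiv_apply_le_half hφ hL x)
  linarith

theorem shear_eq_self {Ω : Set (Rn n)} (h0 : ∀ x, x ∉ Ω → φ x = 0) {x : Rn n} (hx : x ∉ Ω) :
    shear φ h x = x := by simp [shear, h0 x hx]

/-- Points outside `Ω` are fixed, so injectivity prevents points of `Ω` from landing there. -/
theorem shear_mem_iff {L : NNReal} (hφ : LipschitzWith L φ) (hL : L * ‖h‖ ≤ 1 / 2)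
    {Ω : Set (Rn n)} (h0 : ∀ x, x ∉ Ω → φ x = 0) (x : Rn n) : shear φ h x ∈ Ω ↔ x ∈ Ω := by
  obtain ⟨Ψ, hΨ⟩ := exists_homeomorph_shear hφ hL
  constructor
  · intro h1
    by_contra hx
    rw [shear_eq_self h0 hx] at h1
    exact hx h1
  · intro hx
    by_contra h1
    have h2 : shear φ h (shear φ h x) = shear φ h x := shear_eq_self h0 h1
    have h3 : shear φ h x = x := by
      rw [← hΨ, ← hΨ] at h2; rw [← hΨ]; exact Ψ.injective h2
    rw [h3] at h1
    exact h1 hx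

theorem shear_image_mem_iff_of_notMem {L : NNReal} (hφ : LipschitzWith L φ)
    (hL : L * ‖h‖ ≤ 1 / 2) {Ω : Set (Rn n)} (h0 : ∀ x, x ∉ Ω → φ x = 0) (E : Set (Rn n))
    {x : Rn n} (hx : x ∉ Ω) : x ∈ shear φ h '' E ↔ x ∈ E := by
  obtain ⟨Ψ, hΨ⟩ := exists_homeomorph_shear hφ hL
  have hxx : shear φ h x = x := shear_eq_self h0 hx
  constructor
  · rintro ⟨y, hy, hyx⟩
    have : y = x := Ψ.injective (by rw [hΨ, hΨ, hxx, hyx])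
    rwa [← this]
  · exact fun hE => ⟨x, hE, hxx⟩

theorem measurableSet_shear_image {L : NNReal} (hφ : LipschitzWith L φ)
    (hL : L * ‖h‖ ≤ 1 / 2) {E : Set (Rn n)} (hE : MeasurableSet E) :
    MeasurableSet (shear φ h '' E) := by
  obtain ⟨Ψ, hΨ⟩ := exists_homeomorph_shear hφ hL
  have hΨ' : shear φ h = Ψ := funext fun x => (hΨ x).symm
  rw [hΨ']
  exact Ψ.toMeasurableEquiv.measurableSet_image.mpr hE

theorem shear_image_mem_iff_of_eq_one {L : NNReal} (hφ : LipschitzWith L φ)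
    (hL : L * ‖h‖ ≤ 1 / 2) (E : Set (Rn n)) {x : Rn n} (h1 : φ (x - h) = 1) :
    x ∈ shear φ h '' E ↔ x - h ∈ E := by
  obtain ⟨Ψ, hΨ⟩ := exists_homeomorph_shear hφ hL
  have hxx : shear φ h (x - h) = x := by simp [shear, h1]
  constructor
  · rintro ⟨y, hy, hyx⟩
    have : y = x - h := Ψ.injective (by rw [hΨ, hΨ, hxx, hyx])
    rwa [← this]
  · exact fun hE => ⟨x - h, hE, hxx⟩

/-- Change of variables in the perimeter of a deformed set. -/
theorem setLIntegral_cut_shear_image {L : NNReal} (hφ : LipschitzWith L φ)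
    (hL : L * ‖h‖ ≤ 1 / 2) (hd : ContDiff ℝ 1 φ) {Ω E : Set (Rn n)}
    (hΩ : MeasurableSet Ω) (hE : MeasurableSet E) (h0 : ∀ x, x ∉ Ω → φ x = 0)
    {f : Rn n → ℝ≥0∞} (hf : Measurable f) :
    ∫⁻ p in cut Ω (shear φ h '' E), f (p.1 - p.2) =
      ∫⁻ p in cut Ω E, ENNReal.ofReal (1 + fderiv ℝ φ p.1 h) *
        ENNReal.ofReal (1 + fderiv ℝ φ p.2 h) * f (shear φ h p.1 - shear φ h p.2) := by
  obtain ⟨Ψ, hΨ⟩ := exists_homeomorph_shear hφ hL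
  have hΨ' : shear φ h = Ψ := funext fun x => (hΨ x).symm
  have hmp := measurePreserving_shear hφ hL (hd.differentiable one_ne_zero)
  have hJ : Measurable fun x => ENNReal.ofReal (1 + fderiv ℝ φ x h) := by
    have : Continuous fun x => fderiv ℝ φ x h := (hd.continuous_fderiv one_ne_zero).clm_apply
      continuous_const
    exact (measurable_const.add this.measurable).ennreal_ofReal
  have hmp2 := hmp.prod hmp
  rw [prod_withDensity hJ hJ] at hmp2
  have hpre : Prod.map (shear φ h) (shear φ h) ⁻¹' cut Ω (shear φ h '' E) = cut Ω E := by
    ext p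
    simp only [cut, Set.mem_preimage, Set.mem_ofPred_eq, Prod.map_fst, Prod.map_snd,
      shear_mem_iff hφ hL h0]
    rw [hΨ', Ψ.injective.mem_set_image, Ψ.injective.mem_set_image]
  have hcut := measurableSet_cut hΩ (measurableSet_shear_image hφ hL hE)
  have hfm : Measurable fun p : Rn n × Rn n => f (p.1 - p.2) :=
    hf.comp (measurable_fst.sub measurable_snd)
  rw [Measure.volume_eq_prod, ← hmp2.setLIntegral_comp_preimage hcut hfm, hpre]
  exact setLIntegral_withDensity_eq_setLIntegral_mul _
      ((hJ.comp measurable_fst).mul (hJ.comp measurable_snd))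
      (hfm.comp hmp2.measurable) (measurableSet_cut hΩ hE)

/-- The kernel `M` controls the second variation of the kernel `K` along deformations. -/
def SecondVariationBound (K : Rn n → ℝ) (M : Rn n → ℝ≥0∞) : Prop :=
  ∀ z w : Rn n, z ≠ 0 → ‖w‖ ≤ ‖z‖ / 2 → ∀ a b : ℝ, |a| ≤ 1 → |b| ≤ 1 →
    ENNReal.ofReal (K (z + w) * ((1 + a) * (1 + b)) + K (z - w) * ((1 - a) * (1 - b))) ≤
      2 * ENNReal.ofReal (K z) + ENNReal.ofReal (7 * (a ^ 2 + b ^ 2 + (‖w‖ / ‖z‖) ^ 2)) * M z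

/-- The quadratic form in the deformation which controls the second variation. -/
noncomputable def deformationForm (φ : Rn n → ℝ) (h : Rn n) (p : Rn n × Rn n) : ℝ :=
  (fderiv ℝ φ p.1 h) ^ 2 + (fderiv ℝ φ p.2 h) ^ 2 +
    (‖(φ p.1 - φ p.2) • h‖ / ‖p.1 - p.2‖) ^ 2

/-- The key inequality. Minimality is tested against the union and intersection of the two sheared
sets, the second variation bounds the sum of their perimeters, and the gain in submodularity is what
remains on the left. -/
theorem IsKMinimizer.setLIntegral_shear_le {K : Rn n → ℝ} {M : Rn n → ℝ≥0∞}
    (hK : Measurable K) (hK0 : ∀ z, z ≠ 0 → 0 ≤ K z) (hKM : SecondVariationBound K M)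
    {L : NNReal} (hφ : LipschitzWith L φ)
    (hL : L * ‖h‖ ≤ 1 / 2) (hd : ContDiff ℝ 1 φ) {Ω E : Set (Rn n)}
    (hΩ : MeasurableSet Ω) (hE : MeasurableSet E) (h0 : ∀ x, x ∉ Ω → φ x = 0)
    (hmin : IsKMinimizer K Ω E) :
    ∫⁻ p in ((shear φ h '' E \ shear φ (-h) '' E) ×ˢ (shear φ (-h) '' E \ shear φ h '' E)) ∩
        {p | p.1 ∈ Ω ∨ p.2 ∈ Ω}, ENNReal.ofReal (K (p.1 - p.2)) ≤
      ∫⁻ p in cut Ω E, ENNReal.ofReal (7 * deformationForm φ h p) * M (p.1 - p.2) := by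
  have hL' : L * ‖-h‖ ≤ 1 / 2 := by rwa [norm_neg]
  set A := shear φ h '' E with hA
  set B := shear φ (-h) '' E with hB
  have hAm : MeasurableSet A := measurableSet_shear_image hφ hL hE
  have hBm : MeasurableSet B := measurableSet_shear_image hφ hL' hE
  have hAe : ∀ x, x ∉ Ω → (x ∈ A ↔ x ∈ E) := fun x hx =>
    shear_image_mem_iff_of_notMem hφ hL h0 E hx
  have hBe : ∀ x, x ∉ Ω → (x ∈ B ↔ x ∈ E) := fun x hx =>
    shear_image_mem_iff_of_notMem hφ hL' h0 E hx
  set k : Rn n → ℝ≥0∞ := fun z => ENNReal.ofReal (K z) with hk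
  have hkm : Measurable k := hK.ennreal_ofReal
  have hkm2 : Measurable fun p : Rn n × Rn n => k (p.1 - p.2) :=
    hkm.comp (measurable_fst.sub measurable_snd)
  have hJ : ∀ v : Rn n, Measurable fun x => ENNReal.ofReal (1 + fderiv ℝ φ x v) := by
    intro v
    have : Continuous fun x => fderiv ℝ φ x v := (hd.continuous_fderiv one_ne_zero).clm_apply
      continuous_const
    exact (measurable_const.add this.measurable).ennreal_ofReal
  have hsh : ∀ v : Rn n, Measurable (shear φ v) := fun v =>
    (continuous_id.add (hd.continuous.smul continuous_const)).measurable
  have hsum : (∫⁻ p in cut Ω A, k (p.1 - p.2)) + ∫⁻ p in cut Ω B, k (p.1 - p.2) ≤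
      2 * (∫⁻ p in cut Ω E, k (p.1 - p.2)) +
        ∫⁻ p in cut Ω E, ENNReal.ofReal (7 * deformationForm φ h p) * M (p.1 - p.2) := by
    rw [hA, hB, setLIntegral_cut_shear_image hφ hL hd hΩ hE h0 hkm,
      setLIntegral_cut_shear_image hφ hL' hd hΩ hE h0 hkm, ← lintegral_const_mul _ hkm2,
      ← lintegral_add_left (hkm2.const_mul _), ← lintegral_add_left]
    · refine setLIntegral_mono' (measurableSet_cut hΩ hE) fun p hp => ?_
      -- A cut separates `p.1` from `p.2`, so the value of the kernel at the origin never enters.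
      have hne : p.1 - p.2 ≠ 0 := by
        intro h1
        rw [sub_eq_zero] at h1
        exact hp.2.1 (h1 ▸ hp.1)
      set w := (φ p.1 - φ p.2) • h with hw
      have hwn : ‖w‖ ≤ ‖p.1 - p.2‖ / 2 := by
        rw [hw, norm_smul]
        have h1 := hφ.dist_le_mul p.1 p.2
        rw [dist_eq_norm, dist_eq_norm] at h1
        calc ‖φ p.1 - φ p.2‖ * ‖h‖ ≤ L * ‖p.1 - p.2‖ * ‖h‖ := by gcongr
          _ = L * ‖h‖ * ‖p.1 - p.2‖ := by ring
          _ ≤ 1 / 2 * ‖p.1 - p.2‖ := by gcongr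
          _ = _ := by ring
      have ha := abs_fderiv_apply_le_half hφ hL p.1
      have hb := abs_fderiv_apply_le_half hφ hL p.2
      have ha' := abs_le.mp ha
      have hb' := abs_le.mp hb
      have hmain := hKM _ w hne hwn (fderiv ℝ φ p.1 h) (fderiv ℝ φ p.2 h) (by linarith)
        (by linarith)
      refine le_trans (le_of_eq ?_) hmain
      have e1 : shear φ h p.1 - shear φ h p.2 = p.1 - p.2 + w := by
        simp only [shear, hw, sub_smul]; abel
      have e2 : shear φ (-h) p.1 - shear φ (-h) p.2 = p.1 - p.2 - w := by
        simp only [shear, hw, sub_smul, smul_neg]; abel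
      rw [e1, e2, map_neg, map_neg, hk]
      have k1 := hK0 _ (add_smul_ne_zero_of_le_half hne hwn)
      have k2 : 0 ≤ K (p.1 - p.2 - w) := by
        rw [sub_eq_add_neg _ w]
        exact hK0 _ (add_smul_ne_zero_of_le_half hne (by rwa [norm_neg]))
      rw [ENNReal.ofReal_add (mul_nonneg k1 (mul_nonneg (by linarith) (by linarith)))
          (mul_nonneg k2 (mul_nonneg (by linarith) (by linarith))),
        ENNReal.ofReal_mul k1, ENNReal.ofReal_mul k2, ENNReal.ofReal_mul (by linarith),
        ENNReal.ofReal_mul (by linarith), mul_comm (ENNReal.ofReal (K _)),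
        mul_comm (ENNReal.ofReal (K _)), ← sub_eq_add_neg, ← sub_eq_add_neg]
    · exact (((hJ h).comp measurable_fst).mul ((hJ h).comp measurable_snd)).mul
        (hkm.comp (((hsh h).comp measurable_fst).sub ((hsh h).comp measurable_snd)))
  have hsub := setLIntegral_cut_union_add_inter_le (volume : Measure (Rn n × Rn n))
    (fun p => k (p.1 - p.2)) hΩ hAm hBm
  have hU := hmin.le_of_ae hΩ hE.nullMeasurableSet (hAm.union hBm).nullMeasurableSet
    (Filter.Eventually.of_forall fun x hx => by
      rw [Set.mem_union, hAe x hx, hBe x hx, or_self])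
  have hI := hmin.le_of_ae hΩ hE.nullMeasurableSet (hAm.inter hBm).nullMeasurableSet
    (Filter.Eventually.of_forall fun x hx => by
      rw [Set.mem_inter_iff, hAe x hx, hBe x hx, and_self])
  have hfin := hmin.1
  rw [kPerimeter_eq hK hΩ hE] at hU hI hfin
  rw [kPerimeter_eq hK hΩ (hAm.union hBm)] at hU
  rw [kPerimeter_eq hK hΩ (hAm.inter hBm)] at hI
  -- Twice the perimeter of `E` is cancelled in `ℝ≥0∞`; this needs the finiteness built into
  -- minimality.
  refine (ENNReal.add_le_add_iff_left (ENNReal.mul_ne_top ENNReal.ofNat_ne_top hfin.ne)).mp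
    (le_trans ?_ (hsub.trans hsum))
  rw [two_mul]
  gcongr

end

/-! ### Logarithmic cutoffs -/

/-- The sequence `u` jumps once from 0 to 1, so both sums are geometric and comparable to their
first nonzero term; the induction strips leading zeros. Bounding the square of the sum by the sum of
squares without a factor `N` is what makes the cutoff energy decay like `1/N`. -/
theorem sq_sum_geometric_le (N : ℕ) : ∀ u : ℕ → ℝ, (∀ i, u i = 0 ∨ u i = 1) → Monotone u →
    (∑ i ∈ Finset.range N, (1 / 2 : ℝ) ^ i * u i) ^ 2 ≤
      4 * ∑ i ∈ Finset.range N, (1 / 4 : ℝ) ^ i * u i := by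
  induction N with
  | zero => intro u _ _; simp
  | succ N ih =>
    intro u hu hmono
    have h0 : ∀ i, 0 ≤ u i := fun i => by rcases hu i with h | h <;> simp [h]
    have h1 : ∀ i, u i ≤ 1 := fun i => by rcases hu i with h | h <;> simp [h]
    rcases hu 0 with h | h
    · rw [Finset.sum_range_succ', Finset.sum_range_succ', h]
      have := ih (fun i => u (i + 1)) (fun i => hu _) (fun i j hij => hmono (by omega))
      have e1 : ∑ i ∈ Finset.range N, (1 / 2 : ℝ) ^ (i + 1) * u (i + 1) =
          1 / 2 * ∑ i ∈ Finset.range N, (1 / 2 : ℝ) ^ i * u (i + 1) := by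
        rw [Finset.mul_sum]; refine Finset.sum_congr rfl fun i _ => by ring
      have e2 : ∑ i ∈ Finset.range N, (1 / 4 : ℝ) ^ (i + 1) * u (i + 1) =
          1 / 4 * ∑ i ∈ Finset.range N, (1 / 4 : ℝ) ^ i * u (i + 1) := by
        rw [Finset.mul_sum]; refine Finset.sum_congr rfl fun i _ => by ring
      rw [e1, e2]
      nlinarith
    · have hl : ∑ i ∈ Finset.range (N + 1), (1 / 2 : ℝ) ^ i * u i ≤ 2 := by
        calc ∑ i ∈ Finset.range (N + 1), (1 / 2 : ℝ) ^ i * u i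
            ≤ ∑ i ∈ Finset.range (N + 1), (1 / 2 : ℝ) ^ i :=
              Finset.sum_le_sum fun i _ => mul_le_of_le_one_right (by positivity) (h1 i)
          _ ≤ 2 := sum_geometric_two_le _
      have hl0 : 0 ≤ ∑ i ∈ Finset.range (N + 1), (1 / 2 : ℝ) ^ i * u i :=
        Finset.sum_nonneg fun i _ => mul_nonneg (by positivity) (h0 i)
      have hr : 1 ≤ ∑ i ∈ Finset.range (N + 1), (1 / 4 : ℝ) ^ i * u i := by
        rw [Finset.sum_range_succ', h]
        have : 0 ≤ ∑ i ∈ Finset.range N, (1 / 4 : ℝ) ^ (i + 1) * u (i + 1) :=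
          Finset.sum_nonneg fun i _ => mul_nonneg (by positivity) (h0 _)
        simpa using this
      nlinarith

theorem exists_dyadic_cutoffs (n : ℕ) : ∃ (L : NNReal) (η : ℕ → Rn n → ℝ),
    (∀ k, ContDiff ℝ 1 (η k)) ∧ (∀ k, LipschitzWith (L * (1 / 2) ^ k) (η k)) ∧
    (∀ k x, ‖x‖ ≤ 2 ^ k → η k x = 1) ∧ (∀ k x, 2 ^ (k + 1) ≤ ‖x‖ → η k x = 0) := by
  let f : ContDiffBump (0 : Rn n) := ⟨1, 2, one_pos, one_lt_two⟩
  obtain ⟨L, hL⟩ := ContDiff.lipschitzWith_of_hasCompactSupport (𝕂 := ℝ) f.hasCompactSupport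
    (f.contDiff (n := 1)) one_ne_zero
  have hn : ∀ (k : ℕ) (x : Rn n), ‖((1 / 2 : ℝ) ^ k) • x‖ = ‖x‖ / 2 ^ k := by
    intro k x
    rw [norm_smul, norm_pow, Real.norm_of_nonneg (by norm_num), one_div, inv_pow]
    ring
  refine ⟨L, fun k x => f (((1 / 2 : ℝ) ^ k) • x), fun k => ?_, fun k => ?_, fun k x hx => ?_,
    fun k x hx => ?_⟩
  · exact f.contDiff.comp (contDiff_const_smul _)
  · refine LipschitzWith.of_dist_le_mul fun x y => ?_
    refine (hL.dist_le_mul _ _).trans (le_of_eq ?_)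
    rw [dist_eq_norm, dist_eq_norm, ← smul_sub, hn]
    push_cast
    rw [one_div, inv_pow]; ring
  · refine f.one_of_mem_closedBall ?_
    rw [mem_closedBall_zero_iff, hn, div_le_iff₀ (by positivity)]
    simpa [f] using hx
  · refine f.zero_of_le_dist ?_
    rw [dist_zero_right, hn, le_div_iff₀ (by positivity)]
    simpa [f, pow_succ, mul_comm] using hx

theorem fderiv_apply_le_of_lipschitz_of_eq_zero {n : ℕ} {η : Rn n → ℝ} {L : NNReal} {R : ℝ}
    (hL : LipschitzWith L η) (h0 : ∀ x, R ≤ ‖x‖ → η x = 0) (x h : Rn n) {u : ℝ} (hu0 : 0 ≤ u)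
    (hu : ‖x‖ ≤ R → 1 ≤ u) : |fderiv ℝ η x h| ≤ L * u * ‖h‖ := by
  by_cases hx : ‖x‖ ≤ R
  · refine ((fderiv ℝ η x).le_opNorm h).trans (mul_le_mul_of_nonneg_right
      ((norm_fderiv_le_of_lipschitz ℝ hL).trans ?_) (norm_nonneg h))
    exact le_mul_of_one_le_right L.2 (hu hx)
  · have : η =ᶠ[nhds x] fun _ => 0 := by
      filter_upwards [(isOpen_lt continuous_const continuous_norm).mem_nhds (not_le.mp hx)] with y hy
      exact h0 y (le_of_lt hy)
    rw [this.fderiv_eq]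
    simp only [fderiv_fun_const, Pi.zero_apply, zero_apply, abs_zero]
    positivity

open Classical in
/-- Average of cutoffs at `N` successive dyadic scales: it equals one on a given ball, and its
Dirichlet-type energy at all scales is spread over these scales. -/
theorem exists_log_cutoff (n : ℕ) : ∃ L : NNReal, ∀ m N : ℕ, 0 < N → ∃ φ : Rn n → ℝ,
    ContDiff ℝ 1 φ ∧ LipschitzWith (L * (1 / 2) ^ m) φ ∧ (∀ x, ‖x‖ ≤ 2 ^ m → φ x = 1) ∧
    (∀ x, 2 ^ (m + N) ≤ ‖x‖ → φ x = 0) ∧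
    ∀ h p, p.1 ≠ p.2 → deformationForm φ h p ≤ 12 * (L * ‖h‖ / N) ^ 2 *
      ∑ i ∈ Finset.range N, (1 / 4 : ℝ) ^ (m + i) *
        (if p.1 ∈ Metric.ball 0 (2 ^ (m + i + 2)) ∨ p.2 ∈ Metric.ball 0 (2 ^ (m + i + 2))
          then 1 else 0) := by
  obtain ⟨L, η, hc, hl, h1, h0⟩ := exists_dyadic_cutoffs n
  refine ⟨L, fun m N hN => ?_⟩
  have hN' : (0 : ℝ) < N := by exact_mod_cast hN
  set φ : Rn n → ℝ := fun x => (N : ℝ)⁻¹ * ∑ i ∈ Finset.range N, η (m + i) x with hφ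
  have hfd : ∀ x h, fderiv ℝ φ x h = (N : ℝ)⁻¹ * ∑ i ∈ Finset.range N, fderiv ℝ (η (m + i)) x h := by
    intro x h
    have hd : ∀ i ∈ Finset.range N, DifferentiableAt ℝ (η (m + i)) x := fun i _ =>
      ((hc (m + i)).differentiable one_ne_zero) x
    rw [hφ, fderiv_const_mul (DifferentiableAt.fun_sum hd), fderiv_fun_sum hd]
    simp
  have hdiff : ∀ x y, φ x - φ y = (N : ℝ)⁻¹ * ∑ i ∈ Finset.range N, (η (m + i) x - η (m + i) y) := by
    intro x y
    rw [hφ, ← mul_sub, Finset.sum_sub_distrib]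
  have hpow : ∀ i : ℕ, (1 / 2 : ℝ) ^ (m + i) ≤ (1 / 2) ^ m := fun i =>
    pow_le_pow_of_le_one (by norm_num) (by norm_num) (by omega)
  refine ⟨φ, contDiff_const.mul (ContDiff.sum fun i _ => hc _), ?_, ?_, ?_, ?_⟩
  · refine LipschitzWith.of_dist_le_mul fun x y => ?_
    rw [Real.dist_eq, hdiff, abs_mul, abs_of_pos (inv_pos.mpr hN'), inv_mul_le_iff₀ hN']
    refine (Finset.abs_sum_le_sum_abs _ _).trans ?_
    calc ∑ i ∈ Finset.range N, |η (m + i) x - η (m + i) y|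
        ≤ ∑ i ∈ Finset.range N, ((L * (1 / 2) ^ m : NNReal) : ℝ) * dist x y := by
          refine Finset.sum_le_sum fun i _ => ((hl (m + i)).dist_le_mul x y).trans ?_
          push_cast
          have := hpow i
          gcongr
      _ = _ := by simp
  · intro x hx
    have : ∀ i ∈ Finset.range N, η (m + i) x = 1 := fun i _ => h1 _ _ (hx.trans
      (pow_le_pow_right₀ one_le_two (by omega)))
    rw [hφ]; simp only
    rw [Finset.sum_congr rfl this]
    simp [hN'.ne']
  · intro x hx
    have : ∀ i ∈ Finset.range N, η (m + i) x = 0 := fun i hi => h0 _ _ (le_trans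
      (pow_le_pow_right₀ one_le_two (by have := Finset.mem_range.mp hi; omega)) hx)
    rw [hφ]; simp only
    rw [Finset.sum_congr rfl this]
    simp
  · intro h p hp
    set u : ℕ → ℝ := fun i =>
      if p.1 ∈ Metric.ball (0 : Rn n) (2 ^ (m + i + 2)) ∨ p.2 ∈ Metric.ball 0 (2 ^ (m + i + 2))
        then 1 else 0 with hu
    have hu01 : ∀ i, u i = 0 ∨ u i = 1 := fun i => by
      simp only [hu]; split_ifs <;> simp
    have hu0 : ∀ i, 0 ≤ u i := fun i => by rcases hu01 i with h | h <;> simp [h]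
    have hmono : Monotone u := by
      intro i j hij
      have hsub : Metric.ball (0 : Rn n) (2 ^ (m + i + 2)) ⊆ Metric.ball 0 (2 ^ (m + j + 2)) :=
        Metric.ball_subset_ball (pow_le_pow_right₀ one_le_two (by omega))
      by_cases hi : p.1 ∈ Metric.ball (0 : Rn n) (2 ^ (m + i + 2)) ∨
          p.2 ∈ Metric.ball 0 (2 ^ (m + i + 2))
      · have hj := hi.imp (@hsub _) (@hsub _)
        simp only [hu, if_pos hi, if_pos hj, le_refl]
      · have : u i = 0 := if_neg hi
        rw [this]; exact hu0 j
    -- The indicators use open balls of twice the support radius, so that they contain the closed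
    -- supports of the cutoffs.
    have hlt : ∀ i : ℕ, (2 : ℝ) ^ (m + i + 1) < 2 ^ (m + i + 2) := fun i =>
      pow_lt_pow_right₀ one_lt_two (by omega)
    have hu1 : ∀ i, ‖p.1‖ ≤ 2 ^ (m + i + 1) → 1 ≤ u i := fun i hi => by
      have : u i = 1 := if_pos (Or.inl (by rw [mem_ball_zero_iff]; exact hi.trans_lt (hlt i)))
      rw [this]
    have hu2 : ∀ i, ‖p.2‖ ≤ 2 ^ (m + i + 1) → 1 ≤ u i := fun i hi => by
      have : u i = 1 := if_pos (Or.inr (by rw [mem_ball_zero_iff]; exact hi.trans_lt (hlt i)))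
      rw [this]
    set S := ∑ i ∈ Finset.range N, (1 / 2 : ℝ) ^ i * u i with hS
    have hT : ∀ g : ℕ → ℝ, (∀ i, |g i| ≤ ((L * (1 / 2) ^ (m + i) : NNReal) : ℝ) * u i * ‖h‖) →
        ((N : ℝ)⁻¹ * ∑ i ∈ Finset.range N, g i) ^ 2 ≤ (L * ‖h‖ / N * (1 / 2) ^ m * S) ^ 2 := by
      intro g hg
      rw [← sq_abs]
      refine pow_le_pow_left₀ (abs_nonneg _) ?_ 2
      rw [abs_mul, abs_of_pos (inv_pos.mpr hN')]
      have e : L * ‖h‖ / N * (1 / 2) ^ m * S = (N : ℝ)⁻¹ *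
          ∑ i ∈ Finset.range N, ((L * (1 / 2) ^ (m + i) : NNReal) : ℝ) * u i * ‖h‖ := by
        rw [hS, Finset.mul_sum, Finset.mul_sum]
        refine Finset.sum_congr rfl fun i _ => ?_
        push_cast
        rw [pow_add]; ring
      rw [e]
      gcongr
      exact (Finset.abs_sum_le_sum_abs _ _).trans (Finset.sum_le_sum fun i _ => hg i)
    have t1 := hT (fun i => fderiv ℝ (η (m + i)) p.1 h) fun i =>
      fderiv_apply_le_of_lipschitz_of_eq_zero (hl _) (h0 _) _ _ (hu0 i) (hu1 i)
    have t2 := hT (fun i => fderiv ℝ (η (m + i)) p.2 h) fun i =>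
      fderiv_apply_le_of_lipschitz_of_eq_zero (hl _) (h0 _) _ _ (hu0 i) (hu2 i)
    -- The difference quotient obeys the same bound as a derivative: if `u i = 0`, both points lie
    -- outside the support and the difference vanishes.
    have t3 := hT (fun i => (η (m + i) p.1 - η (m + i) p.2) * (‖h‖ / ‖p.1 - p.2‖)) fun i => by
      have hpp : 0 < ‖p.1 - p.2‖ := norm_pos_iff.mpr (sub_ne_zero.mpr hp)
      rw [abs_mul, abs_of_nonneg (by positivity : 0 ≤ ‖h‖ / ‖p.1 - p.2‖), mul_div_assoc',
        div_le_iff₀ hpp]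
      rcases hu01 i with hi | hi
      · have hi1 : 2 ^ (m + i + 1) ≤ ‖p.1‖ := by
          by_contra hc
          linarith [hu1 i (not_le.mp hc).le]
        have hi2 : 2 ^ (m + i + 1) ≤ ‖p.2‖ := by
          by_contra hc
          linarith [hu2 i (not_le.mp hc).le]
        rw [h0 _ _ hi1, h0 _ _ hi2, hi]
        simp
      · have := (hl (m + i)).dist_le_mul p.1 p.2
        rw [Real.dist_eq, dist_eq_norm] at this
        rw [hi, mul_one, mul_right_comm]
        gcongr
    rw [← Finset.sum_mul] at t3
    have e3 : (‖(φ p.1 - φ p.2) • h‖ / ‖p.1 - p.2‖) ^ 2 =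
        ((N : ℝ)⁻¹ * ((∑ i ∈ Finset.range N, (η (m + i) p.1 - η (m + i) p.2)) *
          (‖h‖ / ‖p.1 - p.2‖))) ^ 2 := by
      rw [norm_smul, hdiff, Real.norm_eq_abs, div_pow, mul_pow, sq_abs]
      ring
    -- The constant 12 comes from the three squares in `deformationForm`, each costing the factor 4
    -- in this inequality.
    have hsq := sq_sum_geometric_le N u hu01 hmono
    have e4 : ∑ i ∈ Finset.range N, (1 / 4 : ℝ) ^ (m + i) * u i =
        (1 / 4) ^ m * ∑ i ∈ Finset.range N, (1 / 4 : ℝ) ^ i * u i := by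
      rw [Finset.mul_sum]
      exact Finset.sum_congr rfl fun i _ => by rw [pow_add]; ring
    rw [deformationForm, hfd, hfd, e3, e4]
    have e5 : (L * ‖h‖ / N * (1 / 2) ^ m * S) ^ 2 = (L * ‖h‖ / N) ^ 2 * (1 / 4) ^ m * S ^ 2 := by
      rw [mul_pow, mul_pow, ← pow_mul, mul_comm m 2, pow_mul]; norm_num
    rw [e5] at t1 t2 t3
    have hc : 0 ≤ (L * ‖h‖ / N) ^ 2 * (1 / 4 : ℝ) ^ m := by positivity
    have := mul_le_mul_of_nonneg_left hsq hc
    linarith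

/-- The energy of `E` with kernel `M` grows at most quadratically. -/
def QuadraticGrowth {n : ℕ} (M : Rn n → ℝ≥0∞) (E : Set (Rn n)) : Prop :=
  ∃ C : ℝ, 0 ≤ C ∧ ∀ R : ℝ, 1 ≤ R →
    ∫⁻ p in cut (Metric.ball 0 R) E, M (p.1 - p.2) ≤ ENNReal.ofReal (C * R ^ 2)

theorem setLIntegral_cut_ite_le {n : ℕ} (E : Set (Rn n))
    (f : Rn n × Rn n → ℝ≥0∞) (Ω : Set (Rn n)) {V : Set (Rn n)} (hV : MeasurableSet V)
    [DecidablePred fun p : Rn n × Rn n => p.1 ∈ V ∨ p.2 ∈ V] :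
    ∫⁻ p in cut Ω E, ENNReal.ofReal (if p.1 ∈ V ∨ p.2 ∈ V then 1 else 0) * f p ≤
      ∫⁻ p in cut V E, f p := by
  have hU : MeasurableSet {p : Rn n × Rn n | p.1 ∈ V ∨ p.2 ∈ V} :=
    (measurable_fst hV).union (measurable_snd hV)
  have e : ∀ p : Rn n × Rn n, ENNReal.ofReal (if p.1 ∈ V ∨ p.2 ∈ V then 1 else 0) * f p =
      {p : Rn n × Rn n | p.1 ∈ V ∨ p.2 ∈ V}.indicator f p := by
    intro p
    by_cases hp : p.1 ∈ V ∨ p.2 ∈ V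
    · have hp' : p ∈ {p : Rn n × Rn n | p.1 ∈ V ∨ p.2 ∈ V} := hp
      rw [if_pos hp, Set.indicator_of_mem hp']; simp
    · have hp' : p ∉ {p : Rn n × Rn n | p.1 ∈ V ∨ p.2 ∈ V} := hp
      rw [if_neg hp, Set.indicator_of_notMem hp']; simp
  simp_rw [e]
  rw [lintegral_indicator hU, Measure.restrict_restrict hU]
  refine lintegral_mono_set ?_
  rintro p ⟨hp, hc⟩
  exact ⟨hc.1, hc.2.1, hp⟩

-- At scale `i` the weight `4^-(m+i)` exactly compensates the quadratic growth on a ball of radius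
-- `2^(m+i+2)`, so each scale contributes a constant. The sum over `N` scales, times the prefactor
-- of order `N⁻²`, is `O(1/N)`, uniformly in `m`.
open Classical in
theorem exists_forall_setLIntegral_deformationForm_le {n : ℕ} {M : Rn n → ℝ≥0∞}
    (hM : Measurable M) {E : Set (Rn n)} (hE : MeasurableSet E) (hg : QuadraticGrowth M E)
    (h : Rn n) (L : NNReal) : ∃ C : ℝ, 0 ≤ C ∧ ∀ (m N : ℕ) (φ : Rn n → ℝ) (Ω : Set (Rn n)), 0 < N →
      MeasurableSet Ω →
      (∀ p, p.1 ≠ p.2 → deformationForm φ h p ≤ 12 * (L * ‖h‖ / N) ^ 2 *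
        ∑ i ∈ Finset.range N, (1 / 4 : ℝ) ^ (m + i) *
          (if p.1 ∈ Metric.ball 0 (2 ^ (m + i + 2)) ∨ p.2 ∈ Metric.ball 0 (2 ^ (m + i + 2))
            then 1 else 0)) →
      ∫⁻ p in cut Ω E, ENNReal.ofReal (7 * deformationForm φ h p) * M (p.1 - p.2) ≤
        ENNReal.ofReal (C / N) := by
  obtain ⟨C, hC0, hC⟩ := hg
  -- 84 is `7 * 12`; 16 is the square of the factor 4 between `2^(m+i)` and the radius of the ball.
  refine ⟨84 * (L * ‖h‖) ^ 2 * 16 * C, by positivity, fun m N φ Ω hN hΩ hφ => ?_⟩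
  have hN' : (0 : ℝ) < N := by exact_mod_cast hN
  have hMm : Measurable fun p : Rn n × Rn n => M (p.1 - p.2) :=
    hM.comp (measurable_fst.sub measurable_snd)
  set B : ℕ → Set (Rn n) := fun i => Metric.ball 0 (2 ^ (m + i + 2)) with hB
  have hBm : ∀ i, MeasurableSet (B i) := fun i => measurableSet_ball
  set u : ℕ → Rn n × Rn n → ℝ := fun i p => if p.1 ∈ B i ∨ p.2 ∈ B i then 1 else 0 with hu
  have hu0 : ∀ i p, 0 ≤ u i p := fun i p => by simp only [hu]; split_ifs <;> simp
  have hum : ∀ i, Measurable (u i) := fun i => Measurable.ite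
    ((measurable_fst (hBm i)).union (measurable_snd (hBm i))) measurable_const measurable_const
  have hpt : ∀ p ∈ cut Ω E, ENNReal.ofReal (7 * deformationForm φ h p) * M (p.1 - p.2) ≤
      ENNReal.ofReal (84 * (L * ‖h‖ / N) ^ 2) * ∑ i ∈ Finset.range N,
        ENNReal.ofReal ((1 / 4) ^ (m + i)) * (ENNReal.ofReal (u i p) * M (p.1 - p.2)) := by
    intro p hp
    have hne : p.1 ≠ p.2 := fun h1 => hp.2.1 (h1 ▸ hp.1)
    have h1 : 7 * deformationForm φ h p ≤ 84 * (L * ‖h‖ / N) ^ 2 *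
        ∑ i ∈ Finset.range N, (1 / 4 : ℝ) ^ (m + i) * u i p := by
      have := hφ p hne
      simp only [hu, hB]
      linarith
    have h2 := ENNReal.ofReal_le_ofReal h1
    rw [ENNReal.ofReal_mul (p := 84 * (L * ‖h‖ / N) ^ 2) (by positivity),
      ENNReal.ofReal_sum_of_nonneg
      (fun i _ => mul_nonneg (by positivity) (hu0 i p))] at h2
    refine (mul_le_mul_left h2 _).trans (le_of_eq ?_)
    rw [mul_assoc, Finset.sum_mul]
    congr 1
    refine Finset.sum_congr rfl fun i _ => ?_
    rw [ENNReal.ofReal_mul (by positivity), mul_assoc]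
  refine (setLIntegral_mono' (measurableSet_cut hΩ hE) hpt).trans ?_
  have hm1 : ∀ i, Measurable fun p : Rn n × Rn n => ENNReal.ofReal (u i p) * M (p.1 - p.2) :=
    fun i => (hum i).ennreal_ofReal.mul hMm
  rw [lintegral_const_mul _ (Finset.measurable_fun_sum _ fun i _ => (hm1 i).const_mul _),
    lintegral_finsetSum _ fun i _ => (hm1 i).const_mul _]
  have hterm : ∀ i ∈ Finset.range N, ∫⁻ p in cut Ω E, ENNReal.ofReal ((1 / 4) ^ (m + i)) *
      (ENNReal.ofReal (u i p) * M (p.1 - p.2)) ≤ ENNReal.ofReal (16 * C) := by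
    intro i _
    rw [lintegral_const_mul _ (hm1 i)]
    have h1 := (setLIntegral_cut_ite_le E (fun p => M (p.1 - p.2)) Ω (hBm i)).trans
      (hC (2 ^ (m + i + 2)) (one_le_pow₀ one_le_two))
    refine (mul_le_mul_right h1 _).trans ?_
    rw [← ENNReal.ofReal_mul (by positivity)]
    refine ENNReal.ofReal_le_ofReal (le_of_eq ?_)
    have : ((2 : ℝ) ^ (m + i + 2)) ^ 2 = 4 ^ (m + i) * 16 := by
      rw [← pow_mul, mul_comm, pow_mul, pow_add]; norm_num
    rw [this, one_div, inv_pow]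
    field_simp
  refine (mul_le_mul_right (Finset.sum_le_sum hterm) _).trans ?_
  rw [Finset.sum_const, Finset.card_range, nsmul_eq_mul, ← ENNReal.ofReal_natCast,
    ← ENNReal.ofReal_mul (by positivity), ← ENNReal.ofReal_mul (by positivity)]
  refine ENNReal.ofReal_le_ofReal (le_of_eq ?_)
  field_simp

/-- On a fixed ball the cutoff is 1 and the shears are translations by `±h`, so `A \ B` and `B \ A`
become the two crossing conditions. There `K ≥ 1` turns the interaction bound `C / N` into a bound
on measure, and `N → ∞`. -/
theorem IsKMinimizerInCompacts.volume_crossing_eq_zero {n : ℕ} {K : Rn n → ℝ} {M : Rn n → ℝ≥0∞}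
    (hK : Measurable K) (hK0 : ∀ z, z ≠ 0 → 0 ≤ K z) (hK1 : ∀ z, z ≠ 0 → ‖z‖ < 2 → 1 ≤ K z)
    (hKM : SecondVariationBound K M) (hM : Measurable M) {E : Set (Rn n)} (hE : MeasurableSet E)
    (hg : QuadraticGrowth M E) (hmin : IsKMinimizerInCompacts K E) (h : Rn n) :
    volume {p : Rn n × Rn n | ‖p.1 - p.2‖ < 2 ∧ (p.1 - h ∈ E ∧ p.1 + h ∉ E) ∧
      (p.2 + h ∈ E ∧ p.2 - h ∉ E)} = 0 := by
  obtain ⟨L, hL⟩ := exists_log_cutoff n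
  obtain ⟨C, hC0, hC⟩ := exists_forall_setLIntegral_deformationForm_le hM hE hg h L
  set T : Set (Rn n × Rn n) := {p | ‖p.1 - p.2‖ < 2 ∧ (p.1 - h ∈ E ∧ p.1 + h ∉ E) ∧
      (p.2 + h ∈ E ∧ p.2 - h ∉ E)} with hT
  have hTm : MeasurableSet T := by
    have e1 : Measurable fun p : Rn n × Rn n => p.1 - h := by fun_prop
    have e2 : Measurable fun p : Rn n × Rn n => p.1 + h := by fun_prop
    have e3 : Measurable fun p : Rn n × Rn n => p.2 - h := by fun_prop
    have e4 : Measurable fun p : Rn n × Rn n => p.2 + h := by fun_prop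
    exact (measurableSet_lt (f := fun p : Rn n × Rn n => ‖p.1 - p.2‖) (by fun_prop) measurable_const).inter
      (((e1 hE).inter (e2 hE).compl).inter ((e4 hE).inter (e3 hE).compl))
  have hcover : T ⊆ ⋃ ρ : ℕ, T ∩ {p | ‖p.1‖ ≤ ρ ∧ ‖p.2‖ ≤ ρ} := by
    intro p hp
    obtain ⟨ρ, hρ⟩ := exists_nat_ge (max ‖p.1‖ ‖p.2‖)
    exact Set.mem_iUnion.mpr ⟨ρ, hp, (le_max_left _ _).trans hρ, (le_max_right _ _).trans hρ⟩
  refine measure_mono_null hcover (measure_iUnion_null fun ρ => ?_)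
  -- The first two terms make the cutoff equal 1 wherever it is evaluated below; the last makes the
  -- shear invertible. The choice is independent of `N`.
  obtain ⟨m, hm⟩ : ∃ m : ℕ, ρ + ‖h‖ + 2 * L * ‖h‖ ≤ 2 ^ m :=
    (pow_unbounded_of_one_lt _ one_lt_two).imp fun _ h => h.le
  have hLh : 0 ≤ L * ‖h‖ := by positivity
  have key : ∀ N : ℕ, 0 < N → volume (T ∩ {p | ‖p.1‖ ≤ ρ ∧ ‖p.2‖ ≤ ρ}) ≤ ENNReal.ofReal (C / N) := by
    intro N hN
    obtain ⟨φ, hc, hl, h1, h0, hform⟩ := hL m N hN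
    have hsmall : ((L * (1 / 2) ^ m : NNReal) : ℝ) * ‖h‖ ≤ 1 / 2 := by
      push_cast
      have : (1 / 2 : ℝ) ^ m * 2 ^ m = 1 := by rw [← mul_pow]; norm_num
      have h2 : 0 < (1 / 2 : ℝ) ^ m := by positivity
      have h3 : 2 * (L * ‖h‖) ≤ 2 ^ m := by nlinarith [norm_nonneg h, (Nat.cast_nonneg ρ : (0:ℝ) ≤ ρ)]
      nlinarith [mul_le_mul_of_nonneg_left h3 h2.le]
    have hsmall' : ((L * (1 / 2) ^ m : NNReal) : ℝ) * ‖-h‖ ≤ 1 / 2 := by rwa [norm_neg]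
    set Ω : Set (Rn n) := Metric.ball 0 (2 ^ (m + N)) with hΩ
    have h0' : ∀ x, x ∉ Ω → φ x = 0 := fun x hx => h0 x (by
      rw [hΩ, mem_ball_zero_iff, not_lt] at hx; exact hx)
    have hle := IsKMinimizer.setLIntegral_shear_le hK hK0 hKM hl hsmall hc measurableSet_ball hE h0'
      (hmin Ω Metric.isOpen_ball Metric.isBounded_ball)
    refine le_trans ?_ (hle.trans (hC m N φ Ω hN measurableSet_ball (hform h)))
    rw [← setLIntegral_one]
    have hsub : T ∩ {p | ‖p.1‖ ≤ ρ ∧ ‖p.2‖ ≤ ρ} ⊆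
        ((shear φ h '' E \ shear φ (-h) '' E) ×ˢ (shear φ (-h) '' E \ shear φ h '' E)) ∩
          {p | p.1 ∈ Ω ∨ p.2 ∈ Ω} := by
      rintro p ⟨⟨-, ⟨p1, p2⟩, p3, p4⟩, hp1, hp2⟩
      have hone : ∀ x v : Rn n, ‖x‖ ≤ ρ → ‖v‖ = ‖h‖ → φ (x - v) = 1 := fun x v hx hv =>
        h1 _ ((norm_sub_le _ _).trans (by rw [hv]; nlinarith))
      have hneg : ‖-h‖ = ‖h‖ := norm_neg h
      refine ⟨⟨⟨?_, ?_⟩, ?_, ?_⟩, Or.inl ?_⟩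
      · rwa [shear_image_mem_iff_of_eq_one hl hsmall E (hone _ _ hp1 rfl)]
      · rwa [shear_image_mem_iff_of_eq_one hl hsmall' E (hone _ _ hp1 hneg), sub_neg_eq_add]
      · rwa [shear_image_mem_iff_of_eq_one hl hsmall' E (hone _ _ hp2 hneg), sub_neg_eq_add]
      · rwa [shear_image_mem_iff_of_eq_one hl hsmall E (hone _ _ hp2 rfl)]
      · rw [hΩ, mem_ball_zero_iff]
        by_contra hcon
        have e1 : φ (p.1 - (h - h)) = 1 := by
          refine h1 _ ?_
          rw [sub_self, sub_zero]
          nlinarith [norm_nonneg h]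
        rw [sub_self, sub_zero, h0 _ (not_lt.mp hcon)] at e1
        exact zero_ne_one e1
    refine le_trans ?_ (lintegral_mono_set hsub)
    refine setLIntegral_mono' (hTm.inter ?_) fun p hp => ?_
    · exact (measurableSet_le measurable_fst.norm measurable_const).inter
        (measurableSet_le measurable_snd.norm measurable_const)
    · obtain ⟨⟨hp2, ⟨q1, -⟩, -, q2⟩, -⟩ := hp
      rw [← ENNReal.ofReal_one]
      refine ENNReal.ofReal_le_ofReal (hK1 _ ?_ hp2)
      intro h3
      rw [sub_eq_zero] at h3
      exact q2 (h3 ▸ q1)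
  have hlim : Filter.Tendsto (fun N : ℕ => ENNReal.ofReal (C / N)) Filter.atTop (nhds 0) := by
    rw [← ENNReal.ofReal_zero]
    exact ENNReal.tendsto_ofReal (tendsto_const_div_atTop_nhds_zero_nat C)
  refine le_antisymm (ge_of_tendsto hlim ?_) bot_le
  filter_upwards [Filter.eventually_gt_atTop 0] with N hN using key N hN

/-! ### Quadratic growth of the energy of minimizers -/

section

variable {n : ℕ}

theorem setLIntegral_prod_sub {A B : Set (Rn n)} (hA : MeasurableSet A) (hB : MeasurableSet B)
    {f : Rn n → ℝ≥0∞} (hf : Measurable f) :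
    ∫⁻ p in A ×ˢ B, f (p.1 - p.2) = ∫⁻ z, f z * volume (A ∩ {x | x - z ∈ B}) := by
  have hBs : ∀ z : Rn n, MeasurableSet {x : Rn n | x - z ∈ B} := fun z =>
    (measurable_id.sub_const z) hB
  have hg : Measurable fun p : Rn n × Rn n =>
      A.indicator 1 p.1 * (B.indicator 1 (p.1 - p.2) * f p.2) :=
    ((measurable_one.indicator hA).comp measurable_fst).mul
      (((measurable_one.indicator hB).comp (measurable_fst.sub measurable_snd)).mul
        (hf.comp measurable_snd))
  rw [← lintegral_indicator (hA.prod hB), Measure.volume_eq_prod, lintegral_prod]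
  · have h1 : ∀ x : Rn n, ∫⁻ y, (A ×ˢ B).indicator (fun p : Rn n × Rn n => f (p.1 - p.2)) (x, y) =
        ∫⁻ z, A.indicator 1 x * (B.indicator 1 (x - z) * f z) := by
      intro x
      rw [← lintegral_sub_left_eq_self (fun z => A.indicator 1 x * (B.indicator 1 (x - z) * f z)) x]
      refine lintegral_congr fun y => ?_
      rw [sub_sub_cancel]
      by_cases hx : x ∈ A <;> by_cases hy : y ∈ B <;> simp [hx, hy, Set.indicator]
    simp_rw [h1]
    rw [lintegral_lintegral_swap hg.aemeasurable]
    refine lintegral_congr fun z => ?_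
    have h2 : ∀ x : Rn n, A.indicator 1 x * (B.indicator 1 (x - z) * f z) =
        f z * (A ∩ {x | x - z ∈ B}).indicator 1 x := by
      intro x
      by_cases hx : x ∈ A <;> by_cases hy : x - z ∈ B <;> simp [hx, hy, Set.indicator]
    simp_rw [h2]
    rw [lintegral_const_mul _ (measurable_one.indicator (hA.inter (hBs z))),
      lintegral_indicator_one (hA.inter (hBs z))]
  · exact ((hf.comp (measurable_fst.sub measurable_snd)).indicator (hA.prod hB)).aemeasurable

/-- The measure of the set of points of `E` in a ball which are shifted out of `E`. -/
noncomputable def shiftVolume (E : Set (Rn n)) (R : ℝ) (z : Rn n) : ℝ≥0∞ :=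
  volume ((E ∩ Metric.ball 0 R) ∩ {x | x - z ∈ Eᶜ})

variable {E : Set (Rn n)}

theorem measurable_shiftVolume (hE : MeasurableSet E) (R : ℝ) : Measurable (shiftVolume E R) := by
  have hm : MeasurableSet {p : Rn n × Rn n | (p.2 ∈ E ∧ p.2 ∈ Metric.ball 0 R) ∧ p.2 - p.1 ∈ Eᶜ} :=
    ((measurable_snd hE).inter (measurable_snd measurableSet_ball)).inter
      ((measurable_snd.sub measurable_fst) hE.compl)
  exact measurable_measure_prodMk_left hm

/-- Subadditivity along a two-step path: a point leaving `E` under `z + w` leaves either at the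
first step, or at the second one from `x - z`, which lies in the larger ball. -/
theorem shiftVolume_add_le (E : Set (Rn n)) {R S : ℝ} {z w : Rn n} (h : R + ‖z‖ ≤ S) :
    shiftVolume E R (z + w) ≤ shiftVolume E R z + shiftVolume E S w := by
  have hsub : (E ∩ Metric.ball 0 R) ∩ {x | x - (z + w) ∈ Eᶜ} ⊆
      ((E ∩ Metric.ball 0 R) ∩ {x | x - z ∈ Eᶜ}) ∪
        (fun x => x + (-z)) ⁻¹' ((E ∩ Metric.ball 0 S) ∩ {x | x - w ∈ Eᶜ}) := by
    rintro x ⟨⟨hxE, hxR⟩, hx⟩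
    by_cases hxz : x - z ∈ E
    · right
      refine ⟨⟨by simpa only [← sub_eq_add_neg] using hxz, ?_⟩, ?_⟩
      · rw [mem_ball_zero_iff] at hxR ⊢
        calc ‖x + -z‖ ≤ ‖x‖ + ‖-z‖ := norm_add_le _ _
          _ < R + ‖z‖ := by rw [norm_neg]; gcongr
          _ ≤ S := h
      · change x + -z - w ∈ Eᶜ
        rwa [show x + -z - w = x - (z + w) by abel]
    · left; exact ⟨⟨hxE, hxR⟩, hxz⟩
  refine (measure_mono hsub).trans ((measure_union_le _ _).trans ?_)
  rw [measure_preimage_add_right]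
  rfl

theorem lintegral_mul_shiftVolume_le (hE : MeasurableSet E) {f : Rn n → ℝ≥0∞} (hf : Measurable f)
    (R : ℝ) : ∫⁻ z, f z * shiftVolume E R z ≤ ∫⁻ p in cut (Metric.ball 0 R) E, f (p.1 - p.2) := by
  unfold shiftVolume
  rw [← setLIntegral_prod_sub (hE.inter measurableSet_ball) hE.compl hf]
  refine lintegral_mono_set ?_
  rintro p ⟨⟨h1, h2⟩, h3⟩
  exact ⟨h1, h3, Or.inl h2⟩

theorem setLIntegral_cut_le_lintegral_shiftVolume (hE : MeasurableSet E) {f : Rn n → ℝ≥0∞}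
    (hf : Measurable f) {ρ : ℝ} (hρ : 0 ≤ ρ) (h0 : ∀ z, ρ ≤ ‖z‖ → f z = 0) (R : ℝ) :
    ∫⁻ p in cut (Metric.ball 0 R) E, f (p.1 - p.2) ≤ ∫⁻ z, f z * shiftVolume E (R + ρ) z := by
  unfold shiftVolume
  rw [← setLIntegral_prod_sub (hE.inter measurableSet_ball) hE.compl hf,
    ← lintegral_indicator (measurableSet_cut measurableSet_ball hE),
    ← lintegral_indicator ((hE.inter measurableSet_ball).prod hE.compl)]
  refine lintegral_mono fun p => ?_
  by_cases hp : p ∈ cut (Metric.ball 0 R) E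
  · rw [Set.indicator_of_mem hp]
    rcases le_or_gt ρ ‖p.1 - p.2‖ with h | h
    · rw [h0 _ h]; exact bot_le
    · rw [Set.indicator_of_mem]
      refine ⟨⟨hp.1, ?_⟩, hp.2.1⟩
      rw [mem_ball_zero_iff]
      rcases hp.2.2 with h1 | h1
      · rw [mem_ball_zero_iff] at h1
        linarith
      · rw [mem_ball_zero_iff] at h1
        calc ‖p.1‖ = ‖p.2 + (p.1 - p.2)‖ := by rw [add_sub_cancel]
          _ ≤ ‖p.2‖ + ‖p.1 - p.2‖ := norm_add_le _ _
          _ < R + ρ := add_lt_add h1 h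
  · rw [Set.indicator_of_notMem hp]; exact bot_le

namespace QuadraticGrowth

/-- Since `k ≥ 1` near the origin, the energy bounds the integral of the shift volume over the ball
of radius 2. Averaging subadditivity over intermediate points `w` in the unit ball makes this a
pointwise bound for `‖z‖ < 1`; longer shifts are split into shorter ones. -/
theorem exists_shiftVolume_le {k : Rn n → ℝ≥0∞} (hk : Measurable k)
    (hk1 : ∀ z, z ≠ 0 → ‖z‖ < 2 → 1 ≤ k z) (hE : MeasurableSet E) (hg : QuadraticGrowth k E)
    (m : ℕ) : ∃ C : ℝ, 0 ≤ C ∧ ∀ R : ℝ, 1 ≤ R → ∀ z : Rn n, ‖z‖ < m →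
      shiftVolume E R z ≤ ENNReal.ofReal (C * R ^ 2) := by
  obtain ⟨C, hC0, hC⟩ := hg
  have h0 : ∀ R : ℝ, shiftVolume E R 0 = 0 := by
    intro R
    refine measure_mono_null (t := ∅) ?_ measure_empty
    rintro x ⟨⟨h1, -⟩, h2⟩
    exact h2 (by rwa [sub_zero])
  have hint : ∀ R : ℝ, 1 ≤ R → ∫⁻ w, (Metric.ball (0 : Rn n) 2).indicator (shiftVolume E R) w ≤
      ENNReal.ofReal (C * R ^ 2) := by
    intro R hR
    refine le_trans (lintegral_mono fun w => ?_)
      ((lintegral_mul_shiftVolume_le hE hk R).trans (hC R hR))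
    by_cases hw : w ∈ Metric.ball (0 : Rn n) 2
    · rw [Set.indicator_of_mem hw]
      by_cases hw0 : w = 0
      · rw [hw0, h0]; exact bot_le
      · exact le_mul_of_one_le_left' (hk1 w hw0 (mem_ball_zero_iff.mp hw))
    · rw [Set.indicator_of_notMem hw]; exact bot_le
  set ω := volume (Metric.ball (0 : Rn n) 1) with hω
  have hω0 : 0 < ω := Metric.measure_ball_pos _ _ one_pos
  have hωt : ω ≠ ∞ := measure_ball_lt_top.ne
  have hωr : 0 < ω.toReal := ENNReal.toReal_pos hω0.ne' hωt
  set C₁ := 8 * C / ω.toReal with hC₁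
  have hC₁0 : 0 ≤ C₁ := by positivity
  have hone : ∀ R : ℝ, 1 ≤ R → ∀ z : Rn n, ‖z‖ < 1 →
      shiftVolume E R z ≤ ENNReal.ofReal (C₁ * R ^ 2) := by
    intro R hR z hz
    have hb : ω * shiftVolume E R z ≤
        (∫⁻ w in Metric.ball (0 : Rn n) 1, shiftVolume E R w) +
          ∫⁻ w in Metric.ball (0 : Rn n) 1, shiftVolume E (R + 1) (z - w) := by
      rw [← lintegral_add_left (measurable_shiftVolume hE R), mul_comm, hω, ← setLIntegral_const]
      refine setLIntegral_mono' measurableSet_ball fun w hw => ?_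
      have := shiftVolume_add_le E (R := R) (S := R + 1) (z := w) (w := z - w)
        (by rw [mem_ball_zero_iff] at hw; linarith)
      rwa [add_sub_cancel] at this
    have hb1 : ∫⁻ w in Metric.ball (0 : Rn n) 1, shiftVolume E R w ≤ ENNReal.ofReal (C * R ^ 2) := by
      rw [← lintegral_indicator measurableSet_ball]
      refine le_trans (lintegral_mono fun w => ?_) (hint R hR)
      exact Set.indicator_le_indicator_of_subset (Metric.ball_subset_ball one_le_two)
        (fun _ => bot_le) w
    have hb2 : ∫⁻ w in Metric.ball (0 : Rn n) 1, shiftVolume E (R + 1) (z - w) ≤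
        ENNReal.ofReal (C * (R + 1) ^ 2) := by
      rw [← lintegral_indicator measurableSet_ball]
      refine le_trans (le_trans (lintegral_mono fun w => ?_) (lintegral_sub_left_eq_self
        ((Metric.ball (0 : Rn n) 2).indicator (shiftVolume E (R + 1))) z).le)
        (hint (R + 1) (by linarith))
      by_cases hw : w ∈ Metric.ball (0 : Rn n) 1
      · rw [Set.indicator_of_mem hw, Set.indicator_of_mem]
        rw [mem_ball_zero_iff] at hw ⊢
        refine (norm_sub_le _ _).trans_lt ?_
        linarith
      · rw [Set.indicator_of_notMem hw]; exact bot_le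
    have hb3 : ω * shiftVolume E R z ≤ ENNReal.ofReal (8 * C * R ^ 2) := by
      refine hb.trans ((add_le_add hb1 hb2).trans ?_)
      rw [← ENNReal.ofReal_add (by positivity) (by positivity)]
      refine ENNReal.ofReal_le_ofReal ?_
      nlinarith [mul_le_mul_of_nonneg_left (by nlinarith : (R + 1) ^ 2 ≤ 4 * R ^ 2) hC0,
        mul_nonneg hC0 (sq_nonneg R)]
    have e : ENNReal.ofReal (8 * C * R ^ 2) = ω * ENNReal.ofReal (C₁ * R ^ 2) := by
      conv_rhs => rw [← ENNReal.ofReal_toReal hωt]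
      rw [← ENNReal.ofReal_mul hωr.le, hC₁]
      congr 1
      field_simp
    rw [e] at hb3
    exact (ENNReal.mul_le_mul_iff_right hω0.ne' hωt).mp hb3
  induction m with
  | zero =>
    exact ⟨0, le_rfl, fun R _ z hz => absurd hz (by
      rw [Nat.cast_zero]; exact not_lt.mpr (norm_nonneg z))⟩
  | succ m ih =>
    obtain ⟨D, hD0, hD⟩ := ih
    refine ⟨C₁ + 4 * D, by positivity, fun R hR z hz => ?_⟩
    by_cases hm : m = 0
    · subst hm
      refine (hone R hR z (by simpa using hz)).trans (ENNReal.ofReal_le_ofReal ?_)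
      nlinarith [mul_nonneg hD0 (sq_nonneg R)]
    have hm0 : (0 : ℝ) < m := by exact_mod_cast Nat.pos_of_ne_zero hm
    have hm1 : (0 : ℝ) < m + 1 := by positivity
    push_cast at hz
    -- Chosen so that `t • z` has norm below 1 and `(1 - t) • z` norm below `m`.
    set t : ℝ := 1 / (m + 1) with ht
    have ht0 : 0 < t := by positivity
    have ht1 : t * (m + 1) = 1 := by rw [ht]; field_simp
    have h1 : ‖t • z‖ < 1 := by
      rw [norm_smul, Real.norm_of_nonneg ht0.le]
      nlinarith
    have h2 : ‖(1 - t) • z‖ < m := by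
      have : 1 - t = t * m := by linarith
      rw [norm_smul, this, Real.norm_of_nonneg (by positivity)]
      nlinarith [mul_lt_mul_of_pos_left hz (mul_pos ht0 hm0)]
    have h3 := shiftVolume_add_le E (R := R) (S := R + 1) (z := t • z) (w := (1 - t) • z)
      (by linarith)
    rw [← add_smul, add_sub_cancel, one_smul] at h3
    refine h3.trans ((add_le_add (hone R hR _ h1) (hD (R + 1) (by linarith) _ h2)).trans ?_)
    rw [← ENNReal.ofReal_add (by positivity) (by positivity)]
    refine ENNReal.ofReal_le_ofReal ?_
    nlinarith [mul_le_mul_of_nonneg_left (by nlinarith : (R + 1) ^ 2 ≤ 4 * R ^ 2) hD0]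

/-- Transfers growth from `k` to any integrable kernel of bounded support. Bounding by the volume of
a ball would only give `R^n`, too much in dimension three. -/
theorem of_lintegral_lt_top {k f : Rn n → ℝ≥0∞} (hk : Measurable k)
    (hk1 : ∀ z, z ≠ 0 → ‖z‖ < 2 → 1 ≤ k z) (hE : MeasurableSet E) (hg : QuadraticGrowth k E)
    (hf : Measurable f) (hfi : ∫⁻ z, f z ≠ ∞) {m : ℕ} (h0 : ∀ z, m ≤ ‖z‖ → f z = 0) :
    QuadraticGrowth f E := by
  obtain ⟨C, hC0, hC⟩ := hg.exists_shiftVolume_le hk hk1 hE m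
  refine ⟨(∫⁻ z, f z).toReal * (C * (1 + m) ^ 2), by positivity, fun R hR => ?_⟩
  refine (setLIntegral_cut_le_lintegral_shiftVolume hE hf (Nat.cast_nonneg m) h0 R).trans ?_
  have hmR : (0 : ℝ) ≤ m := Nat.cast_nonneg m
  calc ∫⁻ z, f z * shiftVolume E (R + m) z
      ≤ ∫⁻ z, f z * ENNReal.ofReal (C * (R + m) ^ 2) := by
        refine lintegral_mono fun z => ?_
        rcases le_or_gt (m : ℝ) ‖z‖ with h | h
        · simp [h0 z h]
        · exact mul_le_mul_right (hC (R + m) (by linarith) z h) _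
    _ = (∫⁻ z, f z) * ENNReal.ofReal (C * (R + m) ^ 2) := lintegral_mul_const _ hf
    _ ≤ _ := by
        rw [← ENNReal.ofReal_toReal hfi, ← ENNReal.ofReal_mul ENNReal.toReal_nonneg,
          ENNReal.toReal_ofReal ENNReal.toReal_nonneg]
        refine ENNReal.ofReal_le_ofReal ?_
        rw [mul_assoc, mul_assoc, ← mul_pow]
        gcongr
        nlinarith

theorem add {f g : Rn n → ℝ≥0∞} (hf : Measurable f) (hfE : QuadraticGrowth f E)
    (hgE : QuadraticGrowth g E) : QuadraticGrowth (fun z => f z + g z) E := by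
  obtain ⟨C, hC0, hC⟩ := hfE
  obtain ⟨D, hD0, hD⟩ := hgE
  refine ⟨C + D, by positivity, fun R hR => ?_⟩
  have hfm : Measurable fun p : Rn n × Rn n => f (p.1 - p.2) :=
    hf.comp (measurable_fst.sub measurable_snd)
  rw [lintegral_add_left hfm, add_mul,
    ENNReal.ofReal_add (by positivity) (by positivity)]
  exact add_le_add (hC R hR) (hD R hR)

theorem const_mul {f : Rn n → ℝ≥0∞} (hf : Measurable f) (hfE : QuadraticGrowth f E) {a : ℝ}
    (ha : 0 ≤ a) : QuadraticGrowth (fun z => ENNReal.ofReal a * f z) E := by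
  obtain ⟨C, hC0, hC⟩ := hfE
  refine ⟨a * C, by positivity, fun R hR => ?_⟩
  have hfm : Measurable fun p : Rn n × Rn n => f (p.1 - p.2) :=
    hf.comp (measurable_fst.sub measurable_snd)
  rw [lintegral_const_mul _ hfm, mul_assoc,
    ENNReal.ofReal_mul ha]
  exact mul_le_mul_right (hC R hR) _

/-- Each cut pair has an endpoint in the disc, whose area is already quadratic in `R`, so no
minimality is needed. -/
theorem of_dim_two {f : Rn 2 → ℝ≥0∞} (hf : Measurable f) (hfi : ∫⁻ z, f z ≠ ∞) {E : Set (Rn 2)} :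
    QuadraticGrowth f E := by
  set ω := volume (Metric.ball (0 : Rn 2) 1) with hω
  have hωt : ω ≠ ∞ := measure_ball_lt_top.ne
  refine ⟨2 * (∫⁻ z, f z).toReal * ω.toReal, by positivity, fun R hR => ?_⟩
  have hball : volume (Metric.ball (0 : Rn 2) R) = ENNReal.ofReal (R ^ 2) * ω := by
    rw [Measure.addHaar_ball _ _ (by linarith)]; simp [hω]
  have hsub : cut (Metric.ball 0 R) E ⊆ (Metric.ball (0 : Rn 2) R ×ˢ Set.univ) ∪
      (Set.univ ×ˢ Metric.ball (0 : Rn 2) R) := by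
    rintro p ⟨-, -, h | h⟩
    · exact Or.inl ⟨h, trivial⟩
    · exact Or.inr ⟨trivial, h⟩
  have h1 : ∫⁻ p in Metric.ball (0 : Rn 2) R ×ˢ Set.univ, f (p.1 - p.2) ≤
      (∫⁻ z, f z) * volume (Metric.ball (0 : Rn 2) R) := by
    rw [setLIntegral_prod_sub measurableSet_ball MeasurableSet.univ hf, ← lintegral_mul_const _ hf]
    exact lintegral_mono fun z => mul_le_mul_right (measure_mono Set.inter_subset_left) _
  have h2 : ∫⁻ p in Set.univ ×ˢ Metric.ball (0 : Rn 2) R, f (p.1 - p.2) ≤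
      (∫⁻ z, f z) * volume (Metric.ball (0 : Rn 2) R) := by
    rw [setLIntegral_prod_sub MeasurableSet.univ measurableSet_ball hf, ← lintegral_mul_const _ hf]
    refine lintegral_mono fun z => mul_le_mul_right ?_ _
    refine (measure_mono Set.inter_subset_right).trans (le_of_eq ?_)
    simp_rw [sub_eq_add_neg]
    exact measure_preimage_add_right _ _ _
  refine (lintegral_mono_set hsub).trans ((lintegral_union_le _ _ _).trans
    ((add_le_add h1 h2).trans (le_of_eq ?_)))
  rw [hball, ← ENNReal.ofReal_toReal hfi, ← ENNReal.ofReal_toReal hωt,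
    ← ENNReal.ofReal_mul (by positivity), ← ENNReal.ofReal_mul ENNReal.toReal_nonneg,
    ← ENNReal.ofReal_add (by positivity) (by positivity),
    ENNReal.toReal_ofReal ENNReal.toReal_nonneg, ENNReal.toReal_ofReal ENNReal.toReal_nonneg]
  congr 1; ring

end QuadraticGrowth

end

/-! ### Growth of the perimeter and integrability of the kernel -/

section

variable {n : ℕ} {K Kstar : Rn n → ℝ}

/-- Bernoulli's inequality for `(1 - s/R)^n`. -/
theorem pow_sub_pow_le {n : ℕ} (hn : 1 ≤ n) {R s : ℝ} (hR : 0 < R) (hsR : s ≤ R) :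
    R ^ n - (R - s) ^ n ≤ n * R ^ (n - 1) * s := by
  have h1 := one_add_mul_le_pow (a := -(s / R)) (by
    have : s / R ≤ 1 := (div_le_one hR).mpr hsR
    linarith) n
  have h2 : (R - s) ^ n = R ^ n * (1 + -(s / R)) ^ n := by
    rw [← mul_pow]; congr 1; field_simp; ring
  have h3 : R ^ n = R ^ (n - 1) * R := by rw [← pow_succ]; congr 1; omega
  have h4 : R ^ n * (1 + n * -(s / R)) = R ^ n - n * R ^ (n - 1) * s := by
    rw [h3]; field_simp; ring
  rw [h2]
  have := mul_le_mul_of_nonneg_left h1 (pow_nonneg hR.le n)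
  linarith

theorem volume_ball_diff_ball_le (hn : 1 ≤ n) {R s : ℝ} (hR : 0 < R) (hs : 0 ≤ s) :
    volume (Metric.ball (0 : Rn n) R \ Metric.ball 0 (R - s)) ≤
      ENNReal.ofReal (n * R ^ (n - 1) * s) * volume (Metric.ball (0 : Rn n) 1) := by
  have hfr : Module.finrank ℝ (Rn n) = n := by simp
  have : Nontrivial (Rn n) := Module.nontrivial_of_finrank_pos (R := ℝ) (by rw [hfr]; omega)
  rcases le_or_gt s R with h | h
  · rw [measure_sdiff (Metric.ball_subset_ball (by linarith)) measurableSet_ball.nullMeasurableSet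
      measure_ball_lt_top.ne, Measure.addHaar_ball _ _ hR.le,
      Measure.addHaar_ball _ _ (sub_nonneg.mpr h), hfr, ← ENNReal.sub_mul (fun _ _ =>
        measure_ball_lt_top.ne), ← ENNReal.ofReal_sub _ (pow_nonneg (sub_nonneg.mpr h) n)]
    exact mul_le_mul_left (ENNReal.ofReal_le_ofReal (pow_sub_pow_le hn hR h)) _
  · refine (measure_mono Set.sdiff_subset).trans ?_
    rw [Measure.addHaar_ball _ _ hR.le, hfr]
    refine mul_le_mul_left (ENNReal.ofReal_le_ofReal ?_) _
    have h3 : R ^ n = R ^ (n - 1) * R := by rw [← pow_succ]; congr 1; omega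
    have h4 : (1 : ℝ) ≤ n := by exact_mod_cast hn
    rw [h3]
    have h5 : 0 < R ^ (n - 1) := by positivity
    calc R ^ (n - 1) * R ≤ R ^ (n - 1) * s := by gcongr
      _ ≤ n * (R ^ (n - 1) * s) := le_mul_of_one_le_left (by positivity) h4
      _ = _ := by ring

theorem IsKernel.lintegral_mul_min_ne_top (hK : IsKernel K) :
    ∫⁻ z, ENNReal.ofReal (K z) * ENNReal.ofReal (min 1 ‖z‖) ≠ ∞ := by
  have h1 := hK.integrable.lintegral_lt_top
  refine ne_of_lt (lt_of_le_of_lt (lintegral_mono fun z => ?_) h1)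
  by_cases hz : z = 0
  · simp [hz]
  · rw [← ENNReal.ofReal_mul (hK.nonneg z hz)]

/-- Comparison with `E \ B_R`, whose cut pairs all join the exterior to the ball. A shift by `z`
carries exterior points into the ball only within a shell of thickness `‖z‖`, giving at most `C
R^(n-1) ∫ K(z) ‖z‖ dz`. Compact support makes this integral finite, and `n ≤ 3` gives the exponent
2. -/
theorem IsKMinimizerInCompacts.quadraticGrowth (hK : IsKernel K) (hKm : Measurable K)
    (hn : 1 ≤ n) (hn3 : n ≤ 3) (hsupp : HasCompactSupport K) {E : Set (Rn n)}
    (hE : MeasurableSet E) (hmin : IsKMinimizerInCompacts K E) :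
    QuadraticGrowth (fun z => ENNReal.ofReal (K z)) E := by
  obtain ⟨ρ, hρ⟩ := hsupp.isCompact.isBounded.subset_closedBall 0
  have hρ0 : ∀ z, ρ < ‖z‖ → K z = 0 := fun z hz => image_eq_zero_of_notMem_tsupport fun h => by
    have := hρ h
    rw [mem_closedBall_zero_iff] at this
    linarith
  set k : Rn n → ℝ≥0∞ := fun z => ENNReal.ofReal (K z) with hk
  have hkm : Measurable k := hKm.ennreal_ofReal
  set ω := volume (Metric.ball (0 : Rn n) 1) with hω
  have hωt : ω ≠ ∞ := measure_ball_lt_top.ne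
  set I := ∫⁻ z, k z * ENNReal.ofReal ‖z‖ with hI
  have hIt : I ≠ ∞ := by
    refine ne_top_of_le_ne_top (ENNReal.mul_ne_top hK.lintegral_mul_min_ne_top
      (ENNReal.ofReal_ne_top (r := max 1 ρ))) ?_
    have hmm : Measurable fun z : Rn n => k z * ENNReal.ofReal (min 1 ‖z‖) :=
      hkm.mul (by fun_prop)
    rw [← lintegral_mul_const _ hmm]
    refine lintegral_mono fun z => ?_
    rcases lt_or_ge ρ ‖z‖ with h | h
    · simp [hk, hρ0 z h]
    · rw [mul_assoc, ← ENNReal.ofReal_mul (p := min 1 ‖z‖) (by positivity)]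
      refine mul_le_mul_right (ENNReal.ofReal_le_ofReal ?_) _
      rcases le_total ‖z‖ 1 with h1 | h1
      · rw [min_eq_right h1]
        exact le_mul_of_one_le_right (norm_nonneg _) (le_max_left _ _)
      · rw [min_eq_left h1, one_mul]
        exact h.trans (le_max_right _ _)
  refine ⟨n * I.toReal * ω.toReal, by positivity, fun R hR => ?_⟩
  have hR0 : 0 < R := by linarith
  set Ω := Metric.ball (0 : Rn n) R with hΩ
  have h1 := (hmin Ω Metric.isOpen_ball Metric.isBounded_ball).le_of_ae measurableSet_ball
    hE.nullMeasurableSet (hE.diff (measurableSet_ball (x := 0) (ε := R))).nullMeasurableSet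
    (Filter.Eventually.of_forall fun x hx => by
      simp only [Set.mem_sdiff, and_iff_left_iff_imp]
      exact fun _ => hx)
  rw [kPerimeter_eq hKm measurableSet_ball hE,
    kPerimeter_eq hKm measurableSet_ball (hE.diff measurableSet_ball)] at h1
  refine h1.trans ?_
  have hsub : cut Ω (E \ Metric.ball 0 R) ⊆ Ωᶜ ×ˢ Ω := by
    rintro p ⟨⟨-, h2⟩, -, h3⟩
    exact ⟨h2, h3.resolve_left h2⟩
  refine (lintegral_mono_set hsub).trans ?_
  change ∫⁻ p in Ωᶜ ×ˢ Ω, k (p.1 - p.2) ≤ _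
  rw [setLIntegral_prod_sub measurableSet_ball.compl measurableSet_ball hkm]
  have hvol : ∀ z : Rn n, volume (Ωᶜ ∩ {x | x - z ∈ Ω}) ≤
      ENNReal.ofReal (n * R ^ (n - 1)) * ω * ENNReal.ofReal ‖z‖ := by
    intro z
    have hs : Ωᶜ ∩ {x | x - z ∈ Ω} ⊆ (fun x => x + -z) ⁻¹' (Ω \ Metric.ball 0 (R - ‖z‖)) := by
      rintro x ⟨hx1, hx2⟩
      refine ⟨by simpa only [← sub_eq_add_neg] using (show x - z ∈ Ω from hx2), fun hx3 => hx1 ?_⟩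
      rw [mem_ball_zero_iff] at hx3
      rw [hΩ, mem_ball_zero_iff]
      have := norm_add_le (x + -z) z
      rw [neg_add_cancel_right] at this
      linarith
    refine (measure_mono hs).trans ?_
    rw [measure_preimage_add_right]
    refine (volume_ball_diff_ball_le hn hR0 (norm_nonneg z)).trans (le_of_eq ?_)
    rw [ENNReal.ofReal_mul (by positivity), mul_right_comm]
  calc ∫⁻ z, k z * volume (Ωᶜ ∩ {x | x - z ∈ Ω})
      ≤ ∫⁻ z, ENNReal.ofReal (n * R ^ (n - 1)) * ω * (k z * ENNReal.ofReal ‖z‖) := by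
        refine lintegral_mono fun z => (mul_le_mul_right (hvol z) _).trans (le_of_eq ?_)
        ring
    _ = ENNReal.ofReal (n * R ^ (n - 1)) * ω * I :=
        lintegral_const_mul _ (hkm.mul (by fun_prop))
    _ ≤ _ := by
        conv_lhs => rw [← ENNReal.ofReal_toReal hIt, ← ENNReal.ofReal_toReal hωt]
        rw [← ENNReal.ofReal_mul (by positivity), ← ENNReal.ofReal_mul (by positivity)]
        refine ENNReal.ofReal_le_ofReal ?_
        have h5 : R ^ (n - 1) ≤ R ^ 2 := pow_le_pow_right₀ hR (by omega)
        have h6 : 0 ≤ n * I.toReal * ω.toReal := by positivity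
        nlinarith [mul_le_mul_of_nonneg_left h5 h6]

/-! ### Integrability of the kernel from that of its dominating function. -/

theorem lintegral_comp_smul_three_halves_le (hn : 1 ≤ n) {f : Rn n → ℝ≥0∞} (hf : Measurable f) :
    ∫⁻ z, f ((3 / 2 : ℝ) • z) ≤ ENNReal.ofReal (2 / 3) * ∫⁻ z, f z := by
  have h1 : ∫⁻ z, f ((3 / 2 : ℝ) • z) =
      ∫⁻ z, f z ∂(Measure.map (fun z : Rn n => (3 / 2 : ℝ) • z) volume) :=
    (lintegral_map hf (measurable_const_smul _)).symm
  rw [h1, Measure.map_addHaar_smul _ (by norm_num), lintegral_smul_measure]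
  refine mul_le_mul_left (ENNReal.ofReal_le_ofReal ?_) _
  have hfr : Module.finrank ℝ (Rn n) = n := by simp
  rw [hfr, abs_of_nonneg (by positivity), ← inv_pow]
  calc ((3 / 2 : ℝ)⁻¹) ^ n ≤ ((3 / 2 : ℝ)⁻¹) ^ 1 :=
        pow_le_pow_of_le_one (by norm_num) (by norm_num) hn
    _ = 2 / 3 := by norm_num

theorem le_three_mul_of_le_two_thirds_mul_add {a b : ℝ≥0∞} (ha : a ≠ ∞)
    (h : a ≤ ENNReal.ofReal (2 / 3) * a + b) : a ≤ 3 * b := by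
  by_cases hb : b = ∞
  · rw [hb, ENNReal.mul_top (by norm_num)]; exact le_top
  lift a to NNReal using ha
  lift b to NNReal using hb
  have h1 : ENNReal.ofReal (2 / 3) = ((2 / 3 : NNReal) : ℝ≥0∞) := by
    rw [ENNReal.ofReal, Real.toNNReal_div (by norm_num)]
    norm_num
  rw [h1] at h
  norm_cast at h ⊢
  have h2 : (a : ℝ) ≤ 2 / 3 * a + b := by exact_mod_cast h
  have h3 : (a : ℝ) ≤ 3 * b := by linarith
  exact_mod_cast h3

/-- The first-difference bound gives `K(z) ≤ K(3z/2) + K*(z)`. Integrated over an annulus, the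
dilated term costs at most `2/3` of the integral over that annulus, plus a far part, and is
absorbed. The bound is uniform in the inner radius. -/
theorem DerivBound.lintegral_ne_top (hK : IsKernel K) (hD : DerivBound K Kstar) (hn : 1 ≤ n)
    {S : Rn n → ℝ≥0∞} (hS : Measurable S) (hSi : ∫⁻ z, S z ≠ ∞)
    (hKS : ∀ z, z ≠ 0 → ENNReal.ofReal (Kstar z) ≤ S z) :
    ∫⁻ z, ENNReal.ofReal (K z) ≠ ∞ := by
  set k : Rn n → ℝ≥0∞ := fun z => ENNReal.ofReal (K z) with hk
  have hkm : Measurable k := hD.measurable.ennreal_ofReal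
  have hstep : ∀ z, z ≠ 0 → k z ≤ k ((3 / 2 : ℝ) • z) + S z := by
    intro z hz
    have h1 := (hD.differences (w := (1 / 2 : ℝ) • z) hz (r := 1 / 2)
      (by rw [norm_smul, Real.norm_of_nonneg (by norm_num)]) le_rfl).1
    have h2 : z + (1 / 2 : ℝ) • z = (3 / 2 : ℝ) • z := by
      nth_rewrite 1 [← one_smul ℝ z]
      rw [← add_smul]; norm_num
    rw [h2, abs_le] at h1
    have h3 : K z ≤ K ((3 / 2 : ℝ) • z) + Kstar z := by linarith [h1.1]
    exact (ENNReal.ofReal_le_ofReal h3).trans (ENNReal.ofReal_add_le.trans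
      (add_le_add le_rfl (hKS z hz)))
  have hmin := hK.lintegral_mul_min_ne_top
  set J := ∫⁻ z in {z : Rn n | 1 ≤ ‖z‖}, k z with hJ
  have hm1 : MeasurableSet {z : Rn n | 1 ≤ ‖z‖} := measurableSet_le measurable_const measurable_norm
  have hJt : J ≠ ∞ := by
    refine ne_top_of_le_ne_top hmin ((setLIntegral_mono' hm1 fun z hz => ?_).trans
      (setLIntegral_le_lintegral _ _))
    rw [min_eq_left hz, ENNReal.ofReal_one, mul_one]
  set A : ℕ → Set (Rn n) := fun j => {z | 1 / ((j : ℝ) + 1) ≤ ‖z‖ ∧ ‖z‖ < 1} with hA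
  have hAm : ∀ j, MeasurableSet (A j) := fun j =>
    (measurableSet_le measurable_const measurable_norm).inter
      (measurableSet_lt measurable_norm measurable_const)
  have hne : ∀ j, ∀ z ∈ A j, z ≠ 0 := by
    rintro j z ⟨h1, -⟩ rfl
    rw [norm_zero] at h1
    have : 0 < 1 / ((j : ℝ) + 1) := by positivity
    linarith
  have hAI : ∀ j, ∫⁻ z in A j, k z ≤ 3 * (J + ∫⁻ z, S z) := by
    intro j
    have hj : 0 < 1 / ((j : ℝ) + 1) := by positivity
    -- A priori finiteness, needed for the absorption, is why the annuli stay away from the origin.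
    have hfin : ∫⁻ z in A j, k z ≠ ∞ := by
      refine ne_top_of_le_ne_top (ENNReal.mul_ne_top (ENNReal.ofReal_ne_top (r := (j : ℝ) + 1))
        hmin) ?_
      have hmm : Measurable fun z : Rn n => k z * ENNReal.ofReal (min 1 ‖z‖) :=
        hkm.mul (by fun_prop)
      rw [← lintegral_const_mul _ hmm]
      refine (setLIntegral_mono' (hAm j) fun z hz => ?_).trans (setLIntegral_le_lintegral _ _)
      rw [mul_left_comm, ← ENNReal.ofReal_mul (by positivity)]
      refine le_mul_of_one_le_right' ?_
      rw [ENNReal.one_le_ofReal, min_eq_right hz.2.le]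
      have := mul_le_mul_of_nonneg_left hz.1 (by positivity : 0 ≤ (j : ℝ) + 1)
      rwa [mul_one_div_cancel (by positivity)] at this
    refine le_three_mul_of_le_two_thirds_mul_add hfin ?_
    set B : Set (Rn n) := A j ∪ {z | 1 ≤ ‖z‖} with hB
    have hBm : MeasurableSet B := (hAm j).union hm1
    have h1 : ∫⁻ z in A j, k ((3 / 2 : ℝ) • z) ≤ ∫⁻ z, B.indicator k ((3 / 2 : ℝ) • z) := by
      rw [← lintegral_indicator (hAm j)]
      refine lintegral_mono fun z => ?_
      by_cases hz : z ∈ A j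
      · rw [Set.indicator_of_mem hz, Set.indicator_of_mem]
        have h2 : ‖(3 / 2 : ℝ) • z‖ = 3 / 2 * ‖z‖ := by
          rw [norm_smul, Real.norm_of_nonneg (by norm_num)]
        rcases lt_or_ge ‖(3 / 2 : ℝ) • z‖ 1 with h3 | h3
        · left
          refine ⟨?_, h3⟩
          rw [h2]
          have := hz.1
          have := norm_nonneg z
          linarith
        · right; exact h3
      · rw [Set.indicator_of_notMem hz]; exact bot_le
    have h2 : ∫⁻ z, B.indicator k z ≤ (∫⁻ z in A j, k z) + J := by
      rw [lintegral_indicator hBm]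
      exact lintegral_union_le _ _ _
    calc ∫⁻ z in A j, k z ≤ ∫⁻ z in A j, (k ((3 / 2 : ℝ) • z) + S z) :=
          setLIntegral_mono' (hAm j) fun z hz => hstep z (hne j z hz)
      _ = (∫⁻ z in A j, k ((3 / 2 : ℝ) • z)) + ∫⁻ z in A j, S z := lintegral_add_right _ hS
      _ ≤ ENNReal.ofReal (2 / 3) * ((∫⁻ z in A j, k z) + J) + ∫⁻ z, S z := by
          refine add_le_add (h1.trans ?_) (setLIntegral_le_lintegral _ _)
          exact (lintegral_comp_smul_three_halves_le hn (hkm.indicator hBm)).trans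
            (mul_le_mul_right h2 _)
      _ ≤ _ := by
          rw [mul_add, add_assoc]
          refine add_le_add le_rfl (add_le_add ?_ le_rfl)
          refine mul_le_of_le_one_left' ?_
          rw [ENNReal.ofReal_le_one]; norm_num
  have hcov : ∀ᵐ z ∂(volume : Measure (Rn n)), z ∈ (⋃ j, A j) ∪ {z | 1 ≤ ‖z‖} := by
    have : NeZero n := ⟨by omega⟩
    have h0 : ∀ᵐ z ∂(volume : Measure (Rn n)), z ≠ 0 :=
      measure_eq_zero_iff_ae_notMem.mp (measure_singleton (0 : Rn n))
    filter_upwards [h0] with z hz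
    rcases lt_or_ge ‖z‖ 1 with h | h
    · left
      obtain ⟨j, hj⟩ := exists_nat_one_div_lt (norm_pos_iff.mpr hz)
      exact Set.mem_iUnion.mpr ⟨j, hj.le, h⟩
    · right; exact h
  have hdir : Directed (· ⊆ ·) A := by
    refine Monotone.directed_le fun i j hij z hz => ⟨le_trans ?_ hz.1, hz.2⟩
    exact one_div_le_one_div_of_le (by positivity) (by gcongr)
  rw [← setLIntegral_univ, ← setLIntegral_congr (Filter.eventuallyEq_univ.mpr hcov)]
  refine ne_top_of_le_ne_top ?_ (lintegral_union_le _ _ _)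
  refine ENNReal.add_ne_top.mpr ⟨?_, hJt⟩
  rw [setLIntegral_iUnion_of_directed _ hdir]
  refine ne_top_of_le_ne_top (ENNReal.mul_ne_top (ENNReal.ofNat_ne_top (n := 3))
    (ENNReal.add_ne_top.mpr ⟨hJt, hSi⟩)) (iSup_le hAI)

/-- `Kstar` is only almost everywhere measurable, while it must be dominated at every point; a lower
semicontinuous majorant (Vitali-Carathéodory) does both. -/
theorem exists_measurable_majorant {g : Rn n → ℝ} (hg : Integrable g volume) :
    ∃ f : Rn n → ℝ≥0∞, Measurable f ∧ ∫⁻ z, f z ≠ ∞ ∧ ∀ z, ENNReal.ofReal (g z) ≤ f z := by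
  obtain ⟨f, hfg, hf, hfi⟩ := exists_lt_lowerSemicontinuous_lintegral_ge_of_aemeasurable
    volume (fun z => (g z).toNNReal) hg.aestronglyMeasurable.aemeasurable.real_toNNReal one_ne_zero
  exact ⟨f, hf.measurable, ne_top_of_le_ne_top (ENNReal.add_ne_top.mpr
    ⟨hg.lintegral_lt_top.ne, ENNReal.one_ne_top⟩) hfi, fun z => (hfg z).le⟩

/-- Where `K` vanishes on the whole ball around `z` the left side is zero and `M` is unconstrained;
for compactly supported `K` this allows cutting `K*` off far away. -/
theorem DerivBound.secondVariationBound (hK : IsKernel K) (hD : DerivBound K Kstar)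
    {M : Rn n → ℝ≥0∞}
    (hM : ∀ z, z ≠ 0 → ENNReal.ofReal (K z) + ENNReal.ofReal (Kstar z) ≤ M z ∨
      ∀ w, ‖w‖ ≤ ‖z‖ / 2 → K (z + w) = 0) : SecondVariationBound K M := by
  intro z w hz hw a b ha hb
  rcases hM z hz with h | h
  · refine (ENNReal.ofReal_le_ofReal (hD.second_variation hK.nonneg hz hw ha hb)).trans
      (ENNReal.ofReal_add_le.trans ?_)
    rw [ENNReal.ofReal_mul zero_le_two, ENNReal.ofReal_ofNat, ENNReal.ofReal_mul (by positivity),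
      ENNReal.ofReal_add (hK.nonneg z hz) (hD.nonneg hz)]
    gcongr
  · rw [sub_eq_add_neg z w, h w hw, h (-w) (by rwa [norm_neg])]
    simp

/-- Under the standing assumptions there is a kernel controlling the second variation, with respect
to which minimizers have at most quadratically growing energy. -/
theorem exists_secondVariationBound_quadraticGrowth (hK : IsKernel K) (hD : DerivBound K Kstar)
    (hcase : (n = 2 ∧ Integrable Kstar volume) ∨
      ((n = 2 ∨ n = 3) ∧ HasCompactSupport K ∧ StandingCases K Kstar))
    {E : Set (Rn n)} (hE : MeasurableSet E) (hmin : IsKMinimizerInCompacts K E) :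
    ∃ M : Rn n → ℝ≥0∞, Measurable M ∧ SecondVariationBound K M ∧ QuadraticGrowth M E := by
  have hkm : Measurable fun z => ENNReal.ofReal (K z) := hD.measurable.ennreal_ofReal
  rcases hcase with ⟨rfl, hint⟩ | ⟨hn, hsupp, hst⟩
  · obtain ⟨S, hS, hSi, hKS⟩ := exists_measurable_majorant hint
    refine ⟨fun z => ENNReal.ofReal (K z) + S z, hkm.add hS,
      hD.secondVariationBound hK fun z _ => Or.inl (add_le_add le_rfl (hKS z)),
      QuadraticGrowth.of_dim_two (hkm.add hS) ?_⟩
    change ∫⁻ z, (ENNReal.ofReal (K z) + S z) ≠ ∞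
    rw [lintegral_add_left hkm]
    exact ENNReal.add_ne_top.mpr
      ⟨hD.lintegral_ne_top hK (by norm_num) hS hSi fun z _ => hKS z, hSi⟩
  · obtain ⟨ρ, hρ⟩ := hsupp.isCompact.isBounded.subset_closedBall 0
    have hρ0 : ∀ z, ρ < ‖z‖ → K z = 0 := fun z hz => image_eq_zero_of_notMem_tsupport fun h => by
      have := hρ h
      rw [mem_closedBall_zero_iff] at this
      linarith
    -- If `‖z‖ ≥ m` and `‖w‖ ≤ ‖z‖ / 2`, then `‖z + w‖ > ρ`, outside the support of `K`.
    obtain ⟨m, hm⟩ := exists_nat_gt (2 * ρ)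
    have hg := hmin.quadraticGrowth hK hD.measurable (by omega) (by omega) hsupp hE
    have hbm : MeasurableSet (Metric.ball (0 : Rn n) m) := measurableSet_ball
    -- All three standing cases reduce to `K* ≤ a K + f` with `f` integrable on the ball.
    obtain ⟨a, f, ha, hf, hfi, hKf⟩ : ∃ (a : ℝ) (f : Rn n → ℝ≥0∞), 0 ≤ a ∧ Measurable f ∧
        ∫⁻ z in Metric.ball (0 : Rn n) m, f z ≠ ∞ ∧ ∀ z, z ≠ 0 →
          ENNReal.ofReal (Kstar z) ≤ ENNReal.ofReal a * ENNReal.ofReal (K z) + f z := by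
      rcases hst with ⟨C, hC⟩ | ⟨C, R₀, -, hC⟩ | hint
      · refine ⟨|C|, 0, abs_nonneg C, measurable_zero, by simp, fun z hz => ?_⟩
        rw [Pi.zero_apply, add_zero, ← ENNReal.ofReal_mul (abs_nonneg C), hC z hz]
        exact ENNReal.ofReal_le_ofReal (mul_le_mul_of_nonneg_right (le_abs_self C) (hK.nonneg z hz))
      · refine ⟨|C|, fun _ => ENNReal.ofReal |C|, abs_nonneg C, measurable_const, ?_,
          fun z hz => ?_⟩
        · rw [setLIntegral_const]
          exact ENNReal.mul_ne_top ENNReal.ofReal_ne_top measure_ball_lt_top.ne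
        · rw [← ENNReal.ofReal_mul (abs_nonneg C), ← ENNReal.ofReal_add
            (mul_nonneg (abs_nonneg C) (hK.nonneg z hz)) (abs_nonneg C), hC z hz]
          refine ENNReal.ofReal_le_ofReal ?_
          have h0 : 0 ≤ (Metric.ball (0 : Rn n) R₀).indicator (fun _ => (1 : ℝ)) z :=
            Set.indicator_nonneg (fun _ _ => zero_le_one) z
          have h1 : (Metric.ball (0 : Rn n) R₀).indicator (fun _ => (1 : ℝ)) z ≤ 1 :=
            Set.indicator_le_self' (f := fun _ => (1 : ℝ)) (fun _ _ => zero_le_one) z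
          have h2 := hK.nonneg z hz
          calc C * (K z + (Metric.ball (0 : Rn n) R₀).indicator (fun _ => (1 : ℝ)) z)
              ≤ |C| * (K z + (Metric.ball (0 : Rn n) R₀).indicator (fun _ => (1 : ℝ)) z) :=
                mul_le_mul_of_nonneg_right (le_abs_self C) (add_nonneg h2 h0)
            _ ≤ |C| * (K z + 1) := by gcongr
            _ = _ := by ring
      · obtain ⟨f, hf, hfi, hKf⟩ := exists_measurable_majorant hint
        refine ⟨0, f, le_rfl, hf, ne_top_of_le_ne_top hfi (setLIntegral_le_lintegral _ _),
          fun z _ => ?_⟩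
        rw [ENNReal.ofReal_zero, zero_mul, zero_add]
        exact hKf z
    have hfm : Measurable ((Metric.ball (0 : Rn n) m).indicator f) := hf.indicator hbm
    have hak : Measurable fun z => ENNReal.ofReal a * ENNReal.ofReal (K z) := hkm.const_mul _
    refine ⟨fun z => ENNReal.ofReal (K z) + (ENNReal.ofReal a * ENNReal.ofReal (K z) +
      (Metric.ball (0 : Rn n) m).indicator f z), hkm.add (hak.add hfm),
      hD.secondVariationBound hK fun z hz => ?_, ?_⟩
    · by_cases hzm : z ∈ Metric.ball (0 : Rn n) m
      · left
        rw [Set.indicator_of_mem hzm]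
        exact add_le_add le_rfl (hKf z hz)
      · right
        intro w hw
        apply hρ0
        rw [mem_ball_zero_iff, not_lt] at hzm
        have := norm_sub_norm_le z (-w)
        rw [sub_neg_eq_add, norm_neg] at this
        linarith
    · refine QuadraticGrowth.add hkm hg (QuadraticGrowth.add hak (hg.const_mul hkm ha) ?_)
      refine QuadraticGrowth.of_lintegral_lt_top hkm (fun z hz hz2 => ?_) hE hg hfm (m := m) ?_ ?_
      · rw [ENNReal.one_le_ofReal]; exact hK.one_le z hz hz2
      · rwa [lintegral_indicator hbm]
      · intro z hz
        refine Set.indicator_of_notMem ?_ _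
        rw [mem_ball_zero_iff]
        exact not_lt.mpr hz

end

/-! ### Sets which are comparable with all their translates -/

section

variable {n : ℕ}

/-- By Fubini, if both sets had positive measure, some point of `A` would have `x + g ∉ B` for
almost every `g`, making a translate of `B` null. -/
theorem volume_eq_zero_or_of_forall_translate {A B : Set (Rn n)} (hA : MeasurableSet A)
    (hB : MeasurableSet B) (h : ∀ g : Rn n, ∀ᵐ x ∂volume, x ∈ A → x + g ∉ B) :
    volume A = 0 ∨ volume B = 0 := by
  have hm : MeasurableSet {p : Rn n × Rn n | p.2 ∈ A → p.2 + p.1 ∉ B} := by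
    have : {p : Rn n × Rn n | p.2 ∈ A → p.2 + p.1 ∉ B} =
        ((Prod.snd ⁻¹' A) ∩ ((fun p : Rn n × Rn n => p.2 + p.1) ⁻¹' B))ᶜ := by
      ext p; simp
    rw [this]
    exact ((measurable_snd hA).inter ((measurable_snd.add measurable_fst) hB)).compl
  have h2 := (Measure.ae_ae_comm (μ := (volume : Measure (Rn n))) (ν := (volume : Measure (Rn n)))
    (p := fun g x => x ∈ A → x + g ∉ B) hm).mp (Filter.Eventually.of_forall h)
  by_contra! hcon
  obtain ⟨x, hxA, hx⟩ := ((frequently_ae_mem_iff.mpr hcon.1).and_eventually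
    h2).exists
  refine hcon.2 ?_
  have h3 : volume ((fun g => x + g) ⁻¹' B) = 0 := by
    refine measure_mono_null ?_ (ae_iff.mp hx)
    intro g hg
    simpa [hxA] using hg
  rwa [measure_preimage_add] at h3

/-- `E + d ⊆ E` up to a null set. -/
def ShiftSubset (E : Set (Rn n)) (d : Rn n) : Prop := ∀ᵐ x ∂volume, x ∈ E → x + d ∈ E

theorem ae_add_right {P : Rn n → Prop} (d : Rn n) (h : ∀ᵐ x ∂volume, P x) :
    ∀ᵐ x ∂volume, P (x + d) :=
  (measurePreserving_add_right volume d).quasiMeasurePreserving.ae h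

/-- `A` and `B` hold the points where the shift by `d` leaves or enters `E`. If both had positive
measure, some centred translates `A + h` and `B - h` would overlap in a set `W` of positive measure.
Pairing `x` in `W` near a point `c` with `y` in `W + d` near `c + d` produces crossings of positive
measure. -/
theorem shiftSubset_or_of_crossing {E : Set (Rn n)} (hE : MeasurableSet E)
    (hcross : ∀ h : Rn n, volume {p : Rn n × Rn n | ‖p.1 - p.2‖ < 2 ∧
      (p.1 - h ∈ E ∧ p.1 + h ∉ E) ∧ (p.2 + h ∈ E ∧ p.2 - h ∉ E)} = 0)
    {d : Rn n} (hd : ‖d‖ < 2) : ShiftSubset E d ∨ ShiftSubset E (-d) := by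
  have hEd : MeasurableSet {x | x + d ∈ E} := (measurable_id.add_const d) hE
  set A : Set (Rn n) := {x | x ∈ E ∧ x + d ∉ E} with hA
  set B : Set (Rn n) := {x | x ∉ E ∧ x + d ∈ E} with hB
  have hAm : MeasurableSet A := hE.inter hEd.compl
  have hBm : MeasurableSet B := hE.compl.inter hEd
  have hAB : volume A = 0 ∨ volume B = 0 := by
    refine volume_eq_zero_or_of_forall_translate hAm hBm fun g => ?_
    set h : Rn n := (1 / 2 : ℝ) • g with hh
    have hhg : h + h = g := by rw [hh, ← add_smul]; norm_num
    set W : Set (Rn n) := {x | x - h ∈ A ∧ x + h ∈ B} with hW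
    have hWm : MeasurableSet W :=
      ((measurable_id.sub_const h) hAm).inter ((measurable_id.add_const h) hBm)
    have hW0 : volume W = 0 := by
      by_contra hcon
      obtain ⟨c, -, hc⟩ := exists_mem_forall_mem_nhdsWithin_pos_measure hcon
      -- Then `‖x - y‖ < 2ε + ‖d‖ = 2`, the range where crossings are excluded.
      set ε := (2 - ‖d‖) / 2 with hε
      have hεp : 0 < ε := by rw [hε]; linarith
      have hV := hc (Metric.ball c ε ∩ W)
        (Filter.inter_mem (mem_nhdsWithin_of_mem_nhds (Metric.ball_mem_nhds c hεp))
          self_mem_nhdsWithin)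
      set V := Metric.ball c ε ∩ W with hVdef
      have h1 : V ×ˢ ((fun y => y - d) ⁻¹' V) ⊆ {p : Rn n × Rn n | ‖p.1 - p.2‖ < 2 ∧
          (p.1 - h ∈ E ∧ p.1 + h ∉ E) ∧ (p.2 + h ∈ E ∧ p.2 - h ∉ E)} := by
        rintro ⟨x, y⟩ ⟨⟨hx1, hx2⟩, hy1, hy2⟩
        simp only at hy1 hy2
        refine ⟨?_, ⟨hx2.1.1, hx2.2.1⟩, ?_, ?_⟩
        · rw [Metric.mem_ball] at hx1 hy1
          have h2 : dist x (y - d) < ε + ε := (dist_triangle_right _ _ c).trans_lt (add_lt_add hx1 hy1)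
          rw [dist_eq_norm] at h2
          have h3 : x - y = (x - (y - d)) - d := by abel
          show ‖x - y‖ < 2
          rw [h3]
          refine (norm_sub_le _ _).trans_lt ?_
          linarith
        · have := hy2.2.2
          rwa [show y - d + h + d = y + h by abel] at this
        · have := hy2.1.2
          rwa [show y - d - h + d = y - h by abel] at this
      have h2 := measure_mono_null h1 (hcross h)
      have h3 : volume ((fun y => y - d) ⁻¹' V) = volume V := by
        simp_rw [sub_eq_add_neg]
        exact measure_preimage_add_right _ _ _
      rw [Measure.volume_eq_prod, Measure.prod_prod, h3, mul_self_eq_zero] at h2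
      exact hV.ne' h2
    have h4 : ∀ᵐ x ∂volume, x ∉ W := measure_eq_zero_iff_ae_notMem.mp hW0
    filter_upwards [ae_add_right h h4] with x hx hxA hxB
    exact hx ⟨by rwa [add_sub_cancel_right], by rwa [add_assoc, hhg]⟩
  rcases hAB with h0 | h0
  · left
    filter_upwards [measure_eq_zero_iff_ae_notMem.mp h0] with x hx hxE
    by_contra hcon
    exact hx ⟨hxE, hcon⟩
  · right
    filter_upwards [ae_add_right (-d) (measure_eq_zero_iff_ae_notMem.mp h0)] with x hx hxE
    by_contra hcon
    exact hx ⟨hcon, by rwa [neg_add_cancel_right]⟩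

/-! ### The closed cone of shift directions. -/

namespace ShiftSubset

variable {E : Set (Rn n)}

theorem zero : ShiftSubset E 0 := Filter.Eventually.of_forall fun x hx => by rwa [add_zero]

theorem add {d d' : Rn n} (h : ShiftSubset E d) (h' : ShiftSubset E d') : ShiftSubset E (d + d') := by
  filter_upwards [h, ae_add_right d h'] with x hx hx' hxE
  rw [← add_assoc]
  exact hx' (hx hxE)

theorem nsmul {d : Rn n} (h : ShiftSubset E d) (k : ℕ) : ShiftSubset E (k • d) := by
  induction k with
  | zero => rw [zero_smul]; exact zero
  | succ k ih => rw [succ_nsmul]; exact ih.add h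

/-- Steinhaus: if the limit `d` failed, the bad points `S` respecting all `u k` would have positive
measure, so `u k - d` would be a difference `y' - y` of points of `S` for some `k`. Then `y' + d = y
+ u k` lies both outside and inside `E`. -/
theorem isClosed (hE : MeasurableSet E) : IsClosed {d | ShiftSubset E d} := by
  refine IsSeqClosed.isClosed fun u d hu hlim => ?_
  by_contra hcon
  have hcon' : ¬ ShiftSubset E d := hcon
  set S : Set (Rn n) := {x | x ∈ E ∧ x + d ∉ E} ∩ {x | ∀ k, x ∈ E → x + u k ∈ E} with hS
  have hSm : MeasurableSet S := by
    refine (hE.inter ((measurable_id.add_const d) hE).compl).inter ?_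
    rw [Set.ofPred_forall]
    refine MeasurableSet.iInter fun k => ?_
    have : {x | x ∈ E → x + u k ∈ E} = (E ∩ {x | x + u k ∈ E}ᶜ)ᶜ := by
      ext x; simp
    rw [this]
    exact (hE.inter ((measurable_id.add_const (u k)) hE).compl).compl
  have hS0 : 0 < volume S := by
    rw [pos_iff_ne_zero]
    intro h0
    apply hcon'
    filter_upwards [measure_eq_zero_iff_ae_notMem.mp h0, ae_all_iff.mpr hu] with x hx hxu hxE
    by_contra hxd
    exact hx ⟨⟨hxE, hxd⟩, hxu⟩
  have hnhds := Measure.sub_mem_nhds_zero_of_addHaar_pos volume S hSm hS0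
  have hlim0 : Filter.Tendsto (fun k => u k - d) Filter.atTop (nhds 0) := by
    simpa using hlim.sub_const d
  obtain ⟨k, hk⟩ := (hlim0.eventually hnhds).exists
  obtain ⟨y', hy', y, hy, hyy⟩ := Set.mem_sub.mp hk
  have h1 := hy.2 k hy.1.1
  have h2 := hy'.1.2
  apply h2
  have : y' + d = y + u k := by
    have h3 : y' = u k - d + y := by rw [← hyy]; abel
    rw [h3]; abel
  rwa [this]

theorem or_neg (hsmall : ∀ d : Rn n, ‖d‖ < 2 → ShiftSubset E d ∨ ShiftSubset E (-d)) (d : Rn n) :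
    ShiftSubset E d ∨ ShiftSubset E (-d) := by
  obtain ⟨k, hk⟩ := exists_nat_gt ‖d‖
  have hk0 : (0 : ℝ) < k := (norm_nonneg d).trans_lt hk
  have h1 : ‖(k : ℝ)⁻¹ • d‖ < 2 := by
    rw [norm_smul, norm_inv, Real.norm_natCast, inv_mul_lt_iff₀ hk0]
    linarith
  have h2 : k • ((k : ℝ)⁻¹ • d) = d := by
    rw [← Nat.cast_smul_eq_nsmul ℝ, smul_smul, mul_inv_cancel₀ hk0.ne', one_smul]
  refine (hsmall _ h1).imp (fun h => ?_) fun h => ?_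
  · rw [← h2]; exact h.nsmul k
  · rw [← h2, ← smul_neg]; exact h.nsmul k

theorem inv_smul (hall : ∀ d : Rn n, ShiftSubset E d ∨ ShiftSubset E (-d)) {d : Rn n}
    (hd : ShiftSubset E d) {k : ℕ} (hk : 0 < k) : ShiftSubset E ((k : ℝ)⁻¹ • d) := by
  have hk0 : (k : ℝ) ≠ 0 := by exact_mod_cast hk.ne'
  rcases hall ((k : ℝ)⁻¹ • d) with h | h
  · exact h
  · have h1 := hd.add (h.nsmul (k - 1))
    have : d + (k - 1) • -((k : ℝ)⁻¹ • d) = (k : ℝ)⁻¹ • d := by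
      rw [← Nat.cast_smul_eq_nsmul ℝ, Nat.cast_sub hk, smul_neg, smul_smul, Nat.cast_one, sub_mul,
        mul_inv_cancel₀ hk0, one_mul, sub_smul, one_smul]
      abel
    rwa [this] at h1

theorem real_smul (hE : MeasurableSet E)
    (hall : ∀ d : Rn n, ShiftSubset E d ∨ ShiftSubset E (-d)) {d : Rn n}
    (hd : ShiftSubset E d) {t : ℝ} (ht : 0 ≤ t) : ShiftSubset E (t • d) := by
  have hlim : Filter.Tendsto (fun k : ℕ => ((⌊t * (k : ℝ)⌋₊ : ℝ) / (k : ℝ)) • d) Filter.atTop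
      (nhds (t • d)) :=
    ((tendsto_nat_floor_mul_div_atTop ht).comp tendsto_natCast_atTop_atTop).smul_const d
  refine (isClosed hE).mem_of_tendsto hlim ?_
  filter_upwards [Filter.eventually_gt_atTop 0] with k hk
  have h1 := (inv_smul hall hd hk).nsmul ⌊t * (k : ℝ)⌋₊
  rw [← Nat.cast_smul_eq_nsmul ℝ, smul_smul] at h1
  rwa [div_eq_mul_inv]

/-- The directions form a closed convex cone, proper because `E` and its complement are not null. A
separating functional `f` is nonpositive on it; since `d` or `-d` always belongs, every `d` with `f
d < 0` does, and closedness adds the hyperplane `f = 0`. -/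
theorem exists_halfSpace_directions (hE : MeasurableSet E) (hE₀ : volume E ≠ 0)
    (hE₁ : volume Eᶜ ≠ 0) (hall : ∀ d : Rn n, ShiftSubset E d ∨ ShiftSubset E (-d)) :
    ∃ e : Rn n, ‖e‖ = 1 ∧ ∀ d, inner ℝ e d ≤ 0 → ShiftSubset E d := by
  obtain ⟨v, hv⟩ : ∃ v, ¬ ShiftSubset E v := by
    by_contra! hcon
    refine (volume_eq_zero_or_of_forall_translate hE hE.compl fun g => ?_).elim hE₀ hE₁
    filter_upwards [hcon g] with x hx hxE hxc
    exact hxc (hx hxE)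
  have hconv : Convex ℝ {d | ShiftSubset E d} := by
    intro x hx y hy a b ha hb _
    exact (real_smul hE hall hx ha).add (real_smul hE hall hy hb)
  obtain ⟨f, u, hfu, huv⟩ := geometric_hahn_banach_closed_point hconv (isClosed hE) hv
  have hu0 : 0 < u := by simpa using hfu 0 zero
  have hf0 : ∀ a, ShiftSubset E a → f a ≤ 0 := by
    intro a ha
    by_contra! hcon
    -- A cone element with `f a > 0` could be scaled to reach the separating value `u`.
    have h1 := hfu ((u / f a) • a) (real_smul hE hall ha (by positivity))
    rw [map_smul, smul_eq_mul, div_mul_cancel₀ _ hcon.ne'] at h1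
    exact lt_irrefl _ h1
  have hfv : 0 < f v := hu0.trans huv
  have hneg : ∀ d, f d < 0 → ShiftSubset E d := by
    intro d hd
    refine (hall d).resolve_right fun h => ?_
    have := hf0 _ h
    rw [map_neg] at this
    linarith
  have hle : ∀ d, f d ≤ 0 → ShiftSubset E d := by
    intro d hd
    have hlim : Filter.Tendsto (fun k : ℕ => d - (1 / ((k : ℝ) + 1)) • v) Filter.atTop (nhds d) := by
      have := (tendsto_one_div_add_atTop_nhds_zero_nat (𝕜 := ℝ)).smul_const v
      simpa using this.const_sub d
    refine (isClosed hE).mem_of_tendsto hlim (Filter.Eventually.of_forall fun k => hneg _ ?_)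
    rw [map_sub, map_smul, smul_eq_mul]
    have : 0 < 1 / ((k : ℝ) + 1) * f v := by positivity
    linarith
  set a := (InnerProductSpace.toDual ℝ (Rn n)).symm f with ha
  have hfa : ∀ d, inner ℝ a d = f d := fun d => by
    rw [ha]; exact InnerProductSpace.toDual_symm_apply
  have ha0 : a ≠ 0 := by
    intro h0
    have := hfa v
    rw [h0, inner_zero_left] at this
    linarith
  refine ⟨‖a‖⁻¹ • a, norm_smul_inv_norm (𝕜 := ℝ) ha0, fun d hd => hle d ?_⟩
  rw [real_inner_smul_left, hfa] at hd
  have : 0 < ‖a‖⁻¹ := by positivity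
  by_contra! hcon
  have := mul_pos this hcon
  linarith

end ShiftSubset

/-! ### From a half-space of directions to a half-space. -/

theorem volume_hyperplane (e : Rn n) (he : ‖e‖ = 1) (c : ℝ) :
    volume {x : Rn n | inner ℝ e x = c} = 0 := by
  have he1 : inner ℝ e e = (1 : ℝ) := by rw [real_inner_self_eq_norm_sq, he]; norm_num
  have h0 : volume ((innerSL ℝ e : Rn n →L[ℝ] ℝ).ker : Set (Rn n)) = 0 := by
    refine Measure.addHaar_submodule _ _ fun htop => ?_
    have : e ∈ (innerSL ℝ e : Rn n →L[ℝ] ℝ).ker := by rw [htop]; trivial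
    rw [LinearMap.mem_ker] at this
    simp [he] at this
  have h1 : {x : Rn n | inner ℝ e x = c} =
      (fun x => x + (-(c • e))) ⁻¹' ((innerSL ℝ e : Rn n →L[ℝ] ℝ).ker : Set (Rn n)) := by
    ext x
    simp only [Set.mem_ofPred_eq, Set.mem_preimage, SetLike.mem_coe, LinearMap.mem_ker]
    change _ ↔ inner ℝ e (x + -(c • e)) = 0
    rw [inner_add_right, inner_neg_right, real_inner_smul_right, he1]
    constructor <;> intro h <;> linarith
  rw [h1, measure_preimage_add_right, h0]

/-- By Fubini, almost every `x` in `E` brings with it almost all of the half-space below its own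
level. The threshold `c` is the supremum of the levels whose half-space lies in `E` almost
everywhere. -/
theorem ae_eq_halfSpace_of_shiftSubset {E : Set (Rn n)} (hE : MeasurableSet E)
    (hE₀ : volume E ≠ 0) (hE₁ : volume Eᶜ ≠ 0) {e : Rn n} (he : ‖e‖ = 1)
    (hsh : ∀ d, inner ℝ e d ≤ 0 → ShiftSubset E d) :
    ∃ c : ℝ, E =ᵐ[volume] {x | inner ℝ e x ≤ c} := by
  have hin : Measurable fun x : Rn n => inner ℝ e x := by fun_prop
  have hm : MeasurableSet {p : Rn n × Rn n | inner ℝ e p.1 ≤ (0 : ℝ) → p.2 ∈ E → p.2 + p.1 ∈ E} := by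
    have : {p : Rn n × Rn n | inner ℝ e p.1 ≤ (0 : ℝ) → p.2 ∈ E → p.2 + p.1 ∈ E} =
        ({p : Rn n × Rn n | inner ℝ e p.1 ≤ (0 : ℝ)} ∩ ((Prod.snd ⁻¹' E) ∩
          ((fun p : Rn n × Rn n => p.2 + p.1) ⁻¹' E)ᶜ))ᶜ := by
      ext p; simp
    rw [this]
    exact ((measurableSet_le (hin.comp measurable_fst) measurable_const).inter
      ((measurable_snd hE).inter ((measurable_snd.add measurable_fst) hE).compl)).compl
  have h2 := (Measure.ae_ae_comm (μ := (volume : Measure (Rn n))) (ν := (volume : Measure (Rn n)))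
    (p := fun d x => inner ℝ e d ≤ (0 : ℝ) → x ∈ E → x + d ∈ E) hm).mp
    (Filter.Eventually.of_forall fun d => by
      by_cases hd : inner ℝ e d ≤ (0 : ℝ)
      · filter_upwards [hsh d hd] with x hx _ using hx
      · exact Filter.Eventually.of_forall fun x h => absurd h hd)
  set T : Set ℝ := {t | ∀ᵐ y ∂(volume : Measure (Rn n)), inner ℝ e y ≤ t → y ∈ E} with hT
  have h3 : ∀ᵐ x ∂(volume : Measure (Rn n)), x ∈ E → inner ℝ e x ∈ T := by
    filter_upwards [h2] with x hx hxE
    filter_upwards [ae_add_right (-x) hx] with y hy hyx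
    have := hy (by rw [inner_add_right, inner_neg_right]; linarith) hxE
    rwa [show x + (y + -x) = y by abel] at this
  have hTdown : ∀ t ∈ T, ∀ s ≤ t, s ∈ T := by
    intro t ht s hs
    have ht' : ∀ᵐ y ∂(volume : Measure (Rn n)), inner ℝ e y ≤ t → y ∈ E := ht
    have : ∀ᵐ y ∂(volume : Measure (Rn n)), inner ℝ e y ≤ s → y ∈ E := by
      filter_upwards [ht'] with y hy hys using hy (hys.trans hs)
    exact this
  have hTne : T.Nonempty := by
    obtain ⟨x, hxE, hx⟩ := ((frequently_ae_mem_iff.mpr hE₀).and_eventually h3).exists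
    exact ⟨_, hx hxE⟩
  have hTb : BddAbove T := by
    by_contra hcon
    apply hE₁
    have h4 : ∀ k : ℕ, ∀ᵐ y ∂(volume : Measure (Rn n)), inner ℝ e y ≤ (k : ℝ) → y ∈ E := by
      intro k
      obtain ⟨t, ht, hkt⟩ := not_bddAbove_iff.mp hcon k
      exact hTdown t ht k hkt.le
    refine measure_eq_zero_iff_ae_notMem.mpr ?_
    filter_upwards [ae_all_iff.mpr h4] with y hy hyc
    obtain ⟨k, hk⟩ := exists_nat_ge (inner ℝ e y : ℝ)
    exact hyc (hy k hk)
  refine ⟨sSup T, ?_⟩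
  have h5 : ∀ k : ℕ, ∀ᵐ y ∂(volume : Measure (Rn n)),
      inner ℝ e y ≤ sSup T - 1 / ((k : ℝ) + 1) → y ∈ E := by
    intro k
    have hk : 0 < 1 / ((k : ℝ) + 1) := by positivity
    obtain ⟨t, ht, hkt⟩ := exists_lt_of_lt_csSup hTne (sub_lt_self (sSup T) hk)
    exact hTdown t ht _ hkt.le
  filter_upwards [h3, ae_all_iff.mpr h5,
    measure_eq_zero_iff_ae_notMem.mp (volume_hyperplane e he (sSup T))] with y hy1 hy2 hy3
  apply propext
  constructor
  · exact fun h => le_csSup hTb (hy1 h)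
  · intro h
    have hlt : inner ℝ e y < sSup T := lt_of_le_of_ne h hy3
    obtain ⟨k, hk⟩ := exists_nat_one_div_lt (sub_pos.mpr hlt)
    exact hy2 k (by linarith)

end

/-! ### Half-spaces are minimizers -/

section

variable {n : ℕ}

/-- About `1/s` disjoint translates of the slab piece along `e` fit in the ball of radius `R + 1`;
the factor 2 pays for rounding down. -/
theorem volume_ball_inter_slab_le {e : Rn n} (he : ‖e‖ = 1) (R : ℝ) {s : ℝ} (hs : 0 ≤ s) (a : ℝ) :
    volume (Metric.ball (0 : Rn n) R ∩ {x | a < inner ℝ e x ∧ inner ℝ e x ≤ a + s}) ≤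
      ENNReal.ofReal (min 1 s) * (2 * volume (Metric.ball (0 : Rn n) (R + 1))) := by
  have he1 : inner ℝ e e = (1 : ℝ) := by rw [real_inner_self_eq_norm_sq, he]; norm_num
  set V := Metric.ball (0 : Rn n) R ∩ {x | a < inner ℝ e x ∧ inner ℝ e x ≤ a + s} with hV
  have hin : Measurable fun x : Rn n => (inner ℝ e x : ℝ) := by fun_prop
  have hVm : MeasurableSet V := measurableSet_ball.inter
    ((measurableSet_lt measurable_const hin).inter (measurableSet_le hin measurable_const))
  rcases hs.eq_or_lt with rfl | hs0
  · have : V = ∅ := by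
      refine Set.eq_empty_of_forall_notMem ?_
      rintro x ⟨-, h1, h2⟩
      rw [add_zero] at h2
      exact absurd h1 (not_lt.mpr h2)
    rw [this, measure_empty]; exact bot_le
  rcases le_or_gt 1 s with h1 | h1
  · rw [min_eq_left h1, ENNReal.ofReal_one, one_mul]
    have hRR : R ≤ R + 1 := by linarith
    refine (measure_mono (Set.inter_subset_left.trans (Metric.ball_subset_ball hRR))).trans ?_
    exact le_mul_of_one_le_left' one_le_two
  · rw [min_eq_right h1.le]
    set m := ⌊1 / s⌋₊ with hm
    have hm1 : (m : ℝ) * s ≤ 1 := by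
      have := Nat.floor_le (by positivity : 0 ≤ 1 / s)
      rwa [le_div_iff₀ hs0] at this
    have hm2 : 1 ≤ 2 * s * m := by
      have h2 := Nat.lt_floor_add_one (1 / s)
      rw [div_lt_iff₀ hs0] at h2
      have h3 : (1 : ℝ) ≤ m := by
        have : 1 ≤ m := Nat.le_floor (by rw [Nat.cast_one, le_div_iff₀ hs0]; linarith)
        exact_mod_cast this
      nlinarith
    set W : ℕ → Set (Rn n) := fun j => (fun x => x + -((j * s) • e)) ⁻¹' V with hW
    have hWm : ∀ j, MeasurableSet (W j) := fun j => (measurable_id.add_const _) hVm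
    have hWi : ∀ j x, x ∈ W j → a + j * s < inner ℝ e x ∧ inner ℝ e x ≤ a + (j + 1) * s := by
      rintro j x ⟨-, h2, h3⟩
      simp only [inner_add_right, inner_neg_right, real_inner_smul_right, he1, mul_one] at h2 h3
      constructor <;> linarith
    have hdisj : (↑(Finset.range m) : Set ℕ).PairwiseDisjoint W := by
      have key : ∀ i j : ℕ, i < j → Disjoint (W i) (W j) := by
        intro i j hij
        rw [Set.disjoint_left]
        intro x hx hx'
        have h2 := (hWi i x hx).2
        have h3 := (hWi j x hx').1
        have h4 : ((i : ℝ) + 1) ≤ j := by exact_mod_cast hij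
        nlinarith
      intro i _ j _ hij
      rcases lt_or_gt_of_ne hij with h | h
      · exact key i j h
      · exact (key j i h).symm
    have hsub : (⋃ j ∈ Finset.range m, W j) ⊆ Metric.ball (0 : Rn n) (R + 1) := by
      intro x hx
      simp only [Set.mem_iUnion] at hx
      obtain ⟨j, hj, hx⟩ := hx
      have h2 : x + -((j * s) • e) ∈ Metric.ball (0 : Rn n) R := hx.1
      rw [mem_ball_zero_iff] at h2 ⊢
      have h3 := norm_add_le (x + -((j * s) • e)) ((j * s) • e)
      rw [neg_add_cancel_right, norm_smul, he, mul_one, Real.norm_of_nonneg (by positivity)] at h3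
      have h4 : (j : ℝ) ≤ m := by exact_mod_cast (Finset.mem_range.mp hj).le
      nlinarith
    have hsum := measure_mono (μ := volume) hsub
    rw [measure_biUnion_finset hdisj fun j _ => hWm j] at hsum
    have hWv : ∀ j ∈ Finset.range m, volume (W j) = volume V := fun j _ =>
      measure_preimage_add_right _ _ _
    rw [Finset.sum_congr rfl hWv, Finset.sum_const, Finset.card_range, nsmul_eq_mul] at hsum
    calc volume V ≤ ENNReal.ofReal (2 * s * m) * volume V := by
          refine le_mul_of_one_le_left' ?_
          rwa [ENNReal.one_le_ofReal]
      _ = ENNReal.ofReal s * (2 * (m * volume V)) := by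
          rw [ENNReal.ofReal_mul (by positivity), ENNReal.ofReal_mul zero_le_two,
            ENNReal.ofReal_natCast, ENNReal.ofReal_ofNat]
          ring
      _ ≤ _ := by gcongr

/-- A shift by `z` crosses the boundary only inside a slab of thickness `‖z‖`, so the perimeter is
controlled by `∫ K(z) min(1, ‖z‖) dz`. -/
theorem kPerimeter_halfSpace_lt_top {K : Rn n → ℝ} (hK : IsKernel K) (hKm : Measurable K)
    {e : Rn n} (he : ‖e‖ = 1) (c : ℝ) {Ω : Set (Rn n)} (hΩ : MeasurableSet Ω)
    (hΩb : Bornology.IsBounded Ω) : kPerimeter K Ω {x | inner ℝ e x ≤ c} < ∞ := by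
  obtain ⟨R, hR⟩ := hΩb.subset_ball 0
  set H : Set (Rn n) := {x | inner ℝ e x ≤ c} with hH
  have hin : Measurable fun x : Rn n => (inner ℝ e x : ℝ) := by fun_prop
  have hHm : MeasurableSet H := measurableSet_le hin measurable_const
  set k : Rn n → ℝ≥0∞ := fun z => ENNReal.ofReal (K z) with hk
  have hkm : Measurable k := hKm.ennreal_ofReal
  set B := Metric.ball (0 : Rn n) R with hB
  have hBm : MeasurableSet B := measurableSet_ball
  set C := 2 * volume (Metric.ball (0 : Rn n) (R + 1)) with hC
  have hCt : C ≠ ∞ := ENNReal.mul_ne_top ENNReal.ofNat_ne_top measure_ball_lt_top.ne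
  have hmm : Measurable fun z : Rn n => k z * ENNReal.ofReal (min 1 ‖z‖) := hkm.mul (by fun_prop)
  have hfin : ∫⁻ z, k z * (ENNReal.ofReal (min 1 ‖z‖) * C) ≠ ∞ := by
    simp_rw [← mul_assoc]
    rw [lintegral_mul_const _ hmm]
    exact ENNReal.mul_ne_top hK.lintegral_mul_min_ne_top hCt
  have hez : ∀ z : Rn n, |inner ℝ e z| ≤ ‖z‖ := fun z => by
    have := abs_real_inner_le_norm e z
    rwa [he, one_mul] at this
  have hsub : cut Ω H ⊆ ((H ∩ B) ×ˢ Hᶜ) ∪ (H ×ˢ (Hᶜ ∩ B)) := by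
    rintro p ⟨h1, h2, h3 | h3⟩
    · exact Or.inl ⟨⟨h1, hR h3⟩, h2⟩
    · exact Or.inr ⟨h1, h2, hR h3⟩
  have h1 : ∫⁻ p in (H ∩ B) ×ˢ Hᶜ, k (p.1 - p.2) ≤
      ∫⁻ z, k z * (ENNReal.ofReal (min 1 ‖z‖) * C) := by
    rw [setLIntegral_prod_sub (hHm.inter hBm) hHm.compl hkm]
    refine lintegral_mono fun z => mul_le_mul_right (le_trans (measure_mono ?_)
      (volume_ball_inter_slab_le he R (norm_nonneg z) (c - ‖z‖))) _
    rintro x ⟨⟨hx1, hx2⟩, hx3⟩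
    have h2 : c < inner ℝ e (x - z) := not_le.mp hx3
    have h3 : inner ℝ e x ≤ c := hx1
    rw [inner_sub_right] at h2
    have := abs_le.mp (hez z)
    exact ⟨hx2, by linarith, by linarith⟩
  have h2 : ∫⁻ p in H ×ˢ (Hᶜ ∩ B), k (p.1 - p.2) ≤
      ∫⁻ z, k z * (ENNReal.ofReal (min 1 ‖z‖) * C) := by
    rw [setLIntegral_prod_sub hHm (hHm.compl.inter hBm) hkm]
    refine lintegral_mono fun z => mul_le_mul_right (le_trans ?_
      (volume_ball_inter_slab_le he R (norm_nonneg z) c)) _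
    rw [← measure_preimage_add_right volume (-z) (Metric.ball (0 : Rn n) R ∩ _)]
    refine measure_mono ?_
    rintro x ⟨hx1, hx2, hx3⟩
    have h2 : c < inner ℝ e (x - z) := not_le.mp hx2
    have h3 : inner ℝ e x ≤ c := hx1
    rw [inner_sub_right] at h2
    have := abs_le.mp (hez z)
    have hx3' : x + -z ∈ B := by rw [← sub_eq_add_neg]; exact hx3
    refine ⟨hx3', ?_, ?_⟩ <;> rw [inner_add_right, inner_neg_right] <;> linarith
  rw [kPerimeter_eq hKm hΩ hHm]
  exact lt_of_le_of_lt ((lintegral_mono_set hsub).trans ((lintegral_union_le _ _ _).trans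
    (add_le_add h1 h2))) (ENNReal.add_lt_top.mpr ⟨hfin.lt_top, hfin.lt_top⟩)

theorem setLIntegral_fst_mem_eq {A Ω : Set (Rn n)} (hA : MeasurableSet A)
    (hΩ : MeasurableSet Ω) {g : Rn n → ℝ≥0∞} (hg : Measurable g) :
    ∫⁻ p in {p : Rn n × Rn n | p.1 ∈ A ∧ (p.1 ∈ Ω ∨ p.2 ∈ Ω)}, g (p.1 - p.2) =
      (∫⁻ z, g z) * volume (A ∩ Ω) + ∫⁻ p in (A \ Ω) ×ˢ Ω, g (p.1 - p.2) := by
  have hs : {p : Rn n × Rn n | p.1 ∈ A ∧ (p.1 ∈ Ω ∨ p.2 ∈ Ω)} =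
      ((A ∩ Ω) ×ˢ Set.univ) ∪ ((A \ Ω) ×ˢ Ω) := by
    ext p
    simp only [Set.mem_ofPred_eq, Set.mem_union, Set.mem_prod, Set.mem_inter_iff, Set.mem_univ,
      Set.mem_sdiff]
    tauto
  have hd : Disjoint ((A ∩ Ω) ×ˢ (Set.univ : Set (Rn n))) ((A \ Ω) ×ˢ Ω) := by
    rw [Set.disjoint_left]
    rintro p ⟨⟨-, h1⟩, -⟩ ⟨⟨-, h2⟩, -⟩
    exact h2 h1
  rw [hs, lintegral_union ((hA.diff hΩ).prod hΩ) hd,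
    setLIntegral_prod_sub (hA.inter hΩ) MeasurableSet.univ hg]
  simp only [Set.mem_univ, Set.ofPred_true, Set.inter_univ]
  rw [lintegral_mul_const _ hg]

theorem setLIntegral_snd_mem_eq {A Ω : Set (Rn n)} (hA : MeasurableSet A)
    (hΩ : MeasurableSet Ω) {g : Rn n → ℝ≥0∞} (hg : Measurable g) :
    ∫⁻ p in {p : Rn n × Rn n | p.2 ∈ A ∧ (p.1 ∈ Ω ∨ p.2 ∈ Ω)}, g (p.1 - p.2) =
      (∫⁻ z, g z) * volume (A ∩ Ω) + ∫⁻ p in Ω ×ˢ (A \ Ω), g (p.1 - p.2) := by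
  have hs : {p : Rn n × Rn n | p.2 ∈ A ∧ (p.1 ∈ Ω ∨ p.2 ∈ Ω)} =
      (Set.univ ×ˢ (A ∩ Ω)) ∪ (Ω ×ˢ (A \ Ω)) := by
    ext p
    simp only [Set.mem_ofPred_eq, Set.mem_union, Set.mem_prod, Set.mem_inter_iff, Set.mem_univ,
      Set.mem_sdiff]
    tauto
  have hd : Disjoint ((Set.univ : Set (Rn n)) ×ˢ (A ∩ Ω)) (Ω ×ˢ (A \ Ω)) := by
    rw [Set.disjoint_left]
    rintro p ⟨-, -, h1⟩ ⟨-, -, h2⟩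
    exact h2 h1
  rw [hs, lintegral_union (hΩ.prod (hA.diff hΩ)) hd,
    setLIntegral_prod_sub MeasurableSet.univ (hA.inter hΩ) hg, ← lintegral_mul_const _ hg]
  congr 1
  refine lintegral_congr fun z => ?_
  rw [Set.univ_inter]
  congr 1
  change volume ((fun x => x - z) ⁻¹' (A ∩ Ω)) = _
  simp_rw [sub_eq_add_neg]
  exact measure_preimage_add_right _ _ _

/-- Calibration: half-spaces minimize the perimeter of an integrable kernel. -/
theorem setLIntegral_cut_halfSpace_le {k : Rn n → ℝ≥0∞} (hk : Measurable k)
    (hki : ∫⁻ z, k z ≠ ∞) (e : Rn n) (c : ℝ) {Ω F : Set (Rn n)} (hΩ : MeasurableSet Ω)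
    (hΩt : volume Ω ≠ ∞) (hF : MeasurableSet F) (hFH : F \ Ω = {x | inner ℝ e x ≤ c} \ Ω) :
    ∫⁻ p in cut Ω {x | inner ℝ e x ≤ c}, k (p.1 - p.2) ≤ ∫⁻ p in cut Ω F, k (p.1 - p.2) := by
  have hin : Measurable fun x : Rn n => (inner ℝ e x : ℝ) := by fun_prop
  set H : Set (Rn n) := {x | inner ℝ e x ≤ c} with hH
  have hHm : MeasurableSet H := measurableSet_le hin measurable_const
  have hNm : MeasurableSet {z : Rn n | inner ℝ e z < (0 : ℝ)} := measurableSet_lt hin measurable_const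
  -- The calibrating kernel: it keeps the increments along which a pair can leave the half-space, so
  -- it equals `k` on the cut of `H`.
  set g : Rn n → ℝ≥0∞ := {z : Rn n | inner ℝ e z < (0 : ℝ)}.indicator k with hg
  have hgm : Measurable g := hk.indicator hNm
  have hgk : ∀ z, g z ≤ k z := fun z => Set.indicator_le_self _ _ z
  have hκ : ∫⁻ z, g z ≠ ∞ := ne_top_of_le_ne_top hki (lintegral_mono hgk)
  have hgm2 : Measurable fun p : Rn n × Rn n => g (p.1 - p.2) :=
    hgm.comp (measurable_fst.sub measurable_snd)
  have hUm : MeasurableSet {p : Rn n × Rn n | p.1 ∈ Ω ∨ p.2 ∈ Ω} :=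
    (measurable_fst hΩ).union (measurable_snd hΩ)
  have hfst : ∀ {A : Set (Rn n)}, MeasurableSet A →
      MeasurableSet {p : Rn n × Rn n | p.1 ∈ A ∧ (p.1 ∈ Ω ∨ p.2 ∈ Ω)} := fun hA =>
    (measurable_fst hA).inter hUm
  have hsnd : ∀ {A : Set (Rn n)}, MeasurableSet A →
      MeasurableSet {p : Rn n × Rn n | p.2 ∈ A ∧ (p.1 ∈ Ω ∨ p.2 ∈ Ω)} := fun hA =>
    (measurable_snd hA).inter hUm
  have hfinA : ∀ A : Set (Rn n), (∫⁻ z, g z) * volume (A ∩ Ω) ≠ ∞ := fun A =>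
    ENNReal.mul_ne_top hκ (ne_top_of_le_ne_top hΩt (measure_mono Set.inter_subset_right))
  set c₁ := ∫⁻ p in (H \ Ω) ×ˢ Ω, g (p.1 - p.2) with hc₁
  set c₂ := ∫⁻ p in Ω ×ˢ (H \ Ω), g (p.1 - p.2) with hc₂
  have hc₂t : c₂ ≠ ∞ := by
    rw [hc₂, setLIntegral_prod_sub hΩ (hHm.diff hΩ) hgm]
    refine ne_top_of_le_ne_top (ENNReal.mul_ne_top hκ hΩt) ?_
    rw [← lintegral_mul_const _ hgm]
    exact lintegral_mono fun z => mul_le_mul_right (measure_mono Set.inter_subset_left) _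
  -- Pairs starting in `F` minus pairs ending in `F` are at most the cut pairs. The contributions
  -- `(∫ g) * volume (F ∩ Ω)` cancel, leaving `c₁` and `c₂`, which depend only on the common
  -- exterior.
  have hFle : c₁ ≤ (∫⁻ p in cut Ω F, g (p.1 - p.2)) + c₂ := by
    have h1 : ∫⁻ p in {p : Rn n × Rn n | p.1 ∈ F ∧ (p.1 ∈ Ω ∨ p.2 ∈ Ω)}, g (p.1 - p.2) ≤
        (∫⁻ p in cut Ω F, g (p.1 - p.2)) +
          ∫⁻ p in {p : Rn n × Rn n | p.2 ∈ F ∧ (p.1 ∈ Ω ∨ p.2 ∈ Ω)}, g (p.1 - p.2) := by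
      refine (lintegral_mono_set ?_).trans (lintegral_union_le _ _ _)
      rintro p ⟨h2, h3⟩
      by_cases h4 : p.2 ∈ F
      · exact Or.inr ⟨h4, h3⟩
      · exact Or.inl ⟨h2, h4, h3⟩
    rw [setLIntegral_fst_mem_eq hF hΩ hgm, setLIntegral_snd_mem_eq hF hΩ hgm, hFH,
      add_left_comm] at h1
    exact (ENNReal.add_le_add_iff_left (hfinA F)).mp h1
  -- Equality for `H`: where `g` does not vanish, `p.2 ∈ H` forces `p.1 ∈ H`.
  have hHeq : c₁ = (∫⁻ p in cut Ω H, g (p.1 - p.2)) + c₂ := by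
    have h1 : ∫⁻ p in {p : Rn n × Rn n | p.1 ∈ H ∧ (p.1 ∈ Ω ∨ p.2 ∈ Ω)}, g (p.1 - p.2) =
        (∫⁻ p in cut Ω H, g (p.1 - p.2)) +
          ∫⁻ p in {p : Rn n × Rn n | p.2 ∈ H ∧ (p.1 ∈ Ω ∨ p.2 ∈ Ω)}, g (p.1 - p.2) := by
      have hd : Disjoint (cut Ω H) {p : Rn n × Rn n | p.2 ∈ H ∧ (p.1 ∈ Ω ∨ p.2 ∈ Ω)} := by
        rw [Set.disjoint_left]
        rintro p ⟨-, h1, -⟩ ⟨h2, -⟩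
        exact h1 h2
      rw [← lintegral_union (hsnd hHm) hd, ← lintegral_indicator (hfst hHm),
        ← lintegral_indicator ((measurableSet_cut hΩ hHm).union (hsnd hHm))]
      refine lintegral_congr fun p => ?_
      by_cases hp : inner ℝ e (p.1 - p.2) < (0 : ℝ)
      · have hiff : p ∈ {p : Rn n × Rn n | p.1 ∈ H ∧ (p.1 ∈ Ω ∨ p.2 ∈ Ω)} ↔
            p ∈ cut Ω H ∪ {p : Rn n × Rn n | p.2 ∈ H ∧ (p.1 ∈ Ω ∨ p.2 ∈ Ω)} := by
          have h3 : p.2 ∈ H → p.1 ∈ H := by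
            intro h4
            have h5 : inner ℝ e p.2 ≤ c := h4
            rw [inner_sub_right] at hp
            have h6 : inner ℝ e p.1 ≤ c := by linarith
            exact h6
          simp only [cut, Set.mem_ofPred_eq, Set.mem_union]
          tauto
        by_cases hp2 : p ∈ {p : Rn n × Rn n | p.1 ∈ H ∧ (p.1 ∈ Ω ∨ p.2 ∈ Ω)}
        · rw [Set.indicator_of_mem hp2, Set.indicator_of_mem (hiff.mp hp2)]
        · rw [Set.indicator_of_notMem hp2, Set.indicator_of_notMem fun h => hp2 (hiff.mpr h)]
      · have hg0 : g (p.1 - p.2) = 0 :=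
          Set.indicator_of_notMem (s := {z : Rn n | inner ℝ e z < (0 : ℝ)}) hp _
        simp only [Set.indicator, hg0, ite_self]
    rw [setLIntegral_fst_mem_eq hHm hΩ hgm, setLIntegral_snd_mem_eq hHm hΩ hgm,
      add_left_comm] at h1
    exact (ENNReal.add_right_inj (hfinA H)).mp h1
  have hHk : ∫⁻ p in cut Ω H, k (p.1 - p.2) = ∫⁻ p in cut Ω H, g (p.1 - p.2) := by
    refine setLIntegral_congr_fun (measurableSet_cut hΩ hHm) fun p hp => ?_
    have h1 : inner ℝ e p.1 ≤ c := hp.1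
    have h2 : c < inner ℝ e p.2 := not_le.mp hp.2.1
    refine (Set.indicator_of_mem ?_ k).symm
    change inner ℝ e (p.1 - p.2) < (0 : ℝ)
    rw [inner_sub_right]
    linarith
  rw [hHeq] at hFle
  rw [hHk]
  exact ((ENNReal.add_le_add_iff_right hc₂t).mp hFle).trans (lintegral_mono fun p => hgk _)

theorem isKMinimizer_halfSpace {K : Rn n → ℝ} (hK : IsKernel K) (hKm : Measurable K)
    {e : Rn n} (he : ‖e‖ = 1) (c : ℝ) : IsKMinimizerInCompacts K {x | inner ℝ e x ≤ c} := by
  intro Ω hΩo hΩb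
  have hΩ := hΩo.measurableSet
  refine ⟨kPerimeter_halfSpace_lt_top hK hKm he c hΩ hΩb, fun F hF hFH => ?_⟩
  set H : Set (Rn n) := {x | inner ℝ e x ≤ c} with hH
  have hin : Measurable fun x : Rn n => (inner ℝ e x : ℝ) := by fun_prop
  have hHm : MeasurableSet H := measurableSet_le hin measurable_const
  set k : Rn n → ℝ≥0∞ := fun z => ENNReal.ofReal (K z) with hk
  have hkm : Measurable k := hKm.ennreal_ofReal
  obtain ⟨F₀, -, hF₀m, hF₀⟩ := hF.exists_measurable_superset_ae_eq
  -- A measurable version of `F` that still agrees exactly with `H` outside `Ω`.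
  set G := (F₀ ∩ Ω) ∪ (H \ Ω) with hG
  have hGm : MeasurableSet G := (hF₀m.inter hΩ).union (hHm.diff hΩ)
  have hGF : F =ᵐ[volume] G := by
    filter_upwards [hF₀] with x hx
    have hx' : x ∈ F₀ ↔ x ∈ F := Iff.of_eq hx
    have h3 : x ∈ F \ Ω ↔ x ∈ H \ Ω := by rw [hFH]
    apply propext
    change x ∈ F ↔ (x ∈ F₀ ∧ x ∈ Ω) ∨ x ∈ H \ Ω
    rw [← h3, hx', Set.mem_sdiff]
    tauto
  have hGH : G \ Ω = H \ Ω := by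
    ext x
    simp only [hG, Set.mem_union, Set.mem_inter_iff, Set.mem_sdiff]
    tauto
  rw [kPerimeter_congr hGF, kPerimeter_eq hKm hΩ hHm, kPerimeter_eq hKm hΩ hGm]
  -- The calibration needs an integrable kernel, so pairs closer than `1/(j+1)` are dropped and
  -- restored by monotone convergence.
  set A : ℕ → Set (Rn n × Rn n) := fun j => {p | 1 / ((j : ℝ) + 1) < ‖p.1 - p.2‖} with hA
  have hAm : ∀ j, MeasurableSet (A j) := fun j =>
    measurableSet_lt measurable_const (measurable_fst.sub measurable_snd).norm
  have hcov : cut Ω H ⊆ ⋃ j, cut Ω H ∩ A j := by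
    intro p hp
    have hne : p.1 - p.2 ≠ 0 := fun h => by
      rw [sub_eq_zero] at h
      exact hp.2.1 (h ▸ hp.1)
    obtain ⟨j, hj⟩ := exists_nat_one_div_lt (norm_pos_iff.mpr hne)
    exact Set.mem_iUnion.mpr ⟨j, hp, hj⟩
  have hdir : Directed (· ⊆ ·) fun j => cut Ω H ∩ A j := by
    refine Monotone.directed_le fun i j hij p hp => ⟨hp.1, ?_⟩
    have hp2 : 1 / ((i : ℝ) + 1) < ‖p.1 - p.2‖ := hp.2
    refine lt_of_le_of_lt ?_ hp2
    exact one_div_le_one_div_of_le (by positivity) (by gcongr)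
  refine (lintegral_mono_set hcov).trans ?_
  rw [setLIntegral_iUnion_of_directed _ hdir]
  refine iSup_le fun j => ?_
  have hj : 0 < 1 / ((j : ℝ) + 1) := by positivity
  have hTm : MeasurableSet {z : Rn n | 1 / ((j : ℝ) + 1) < ‖z‖} :=
    measurableSet_lt measurable_const measurable_norm
  set kj : Rn n → ℝ≥0∞ := {z : Rn n | 1 / ((j : ℝ) + 1) < ‖z‖}.indicator k with hkj
  have hkjm : Measurable kj := hkm.indicator hTm
  have hkji : ∫⁻ z, kj z ≠ ∞ := by
    have hmm : Measurable fun z : Rn n => k z * ENNReal.ofReal (min 1 ‖z‖) :=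
      hkm.mul (by fun_prop)
    refine ne_top_of_le_ne_top (ENNReal.mul_ne_top (ENNReal.ofReal_ne_top (r := (j : ℝ) + 1))
      hK.lintegral_mul_min_ne_top) ?_
    rw [← lintegral_const_mul _ hmm, hkj, lintegral_indicator hTm]
    refine (setLIntegral_mono' hTm fun z hz => ?_).trans (setLIntegral_le_lintegral _ _)
    rw [mul_left_comm, ← ENNReal.ofReal_mul (by positivity)]
    refine le_mul_of_one_le_right' ?_
    rw [ENNReal.one_le_ofReal]
    have hz' : 1 / ((j : ℝ) + 1) ≤ min 1 ‖z‖ := by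
      refine le_min ?_ (le_of_lt hz)
      rw [div_le_one (by positivity)]
      linarith [(Nat.cast_nonneg j : (0 : ℝ) ≤ j)]
    have := mul_le_mul_of_nonneg_left hz' (by positivity : 0 ≤ (j : ℝ) + 1)
    rwa [mul_one_div_cancel (by positivity)] at this
  have hle := setLIntegral_cut_halfSpace_le hkjm hkji e c hΩ hΩb.measure_lt_top.ne hGm hGH
  calc ∫⁻ p in cut Ω H ∩ A j, k (p.1 - p.2)
      = ∫⁻ p in cut Ω H ∩ A j, kj (p.1 - p.2) := by
        refine setLIntegral_congr_fun ((measurableSet_cut hΩ hHm).inter (hAm j)) fun p hp => ?_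
        exact (Set.indicator_of_mem (show p.1 - p.2 ∈ {z : Rn n | 1 / ((j : ℝ) + 1) < ‖z‖} from
          hp.2) k).symm
    _ ≤ ∫⁻ p in cut Ω H, kj (p.1 - p.2) := lintegral_mono_set Set.inter_subset_left
    _ ≤ ∫⁻ p in cut Ω G, kj (p.1 - p.2) := hle
    _ ≤ ∫⁻ p in cut Ω G, k (p.1 - p.2) := lintegral_mono fun p => Set.indicator_le_self _ _ _

end

/-! ### Assembly of both implications. -/

theorem IsKMinimizerInCompacts.congr {n : ℕ} {K : Rn n → ℝ} {E F : Set (Rn n)}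
    (h : IsKMinimizerInCompacts K E) (hE : NullMeasurableSet E volume) (hEF : E =ᵐ[volume] F) :
    IsKMinimizerInCompacts K F := fun Ω hΩ hΩb =>
  (h Ω hΩ hΩb).congr hΩ.measurableSet hE hEF

theorem mainTheorem12 {n : ℕ} (K Kstar : Rn n → ℝ) (hK : IsKernel K)
    (hKstar : DerivBound K Kstar)
    (hcase : (n = 2 ∧ Integrable Kstar volume) ∨
      ((n = 2 ∨ n = 3) ∧ HasCompactSupport K ∧ StandingCases K Kstar))
    (E : Set (Rn n)) (hE : NullMeasurableSet E volume)
    (hE₀ : volume E ≠ 0) (hE₁ : volume Eᶜ ≠ 0) :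
    IsKMinimizerInCompacts K E ↔ ∃ H : Set (Rn n), IsHalfSpace H ∧ E =ᵐ[volume] H := by
  constructor
  · intro hmin
    obtain ⟨E', -, hE'm, hE'⟩ := hE.exists_measurable_superset_ae_eq
    have hmin' : IsKMinimizerInCompacts K E' := hmin.congr hE hE'.symm
    have h₀ : volume E' ≠ 0 := by rwa [measure_congr hE']
    have h₁ : volume E'ᶜ ≠ 0 := by rwa [measure_congr hE'.compl]
    obtain ⟨M, hM, hKM, hg⟩ :=
      exists_secondVariationBound_quadraticGrowth hK hKstar hcase hE'm hmin'
    have hall := ShiftSubset.or_neg fun d hd => shiftSubset_or_of_crossing hE'm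
      (hmin'.volume_crossing_eq_zero hKstar.measurable hK.nonneg hK.one_le hKM hM hE'm hg) hd
    obtain ⟨e, he, hsh⟩ := ShiftSubset.exists_halfSpace_directions hE'm h₀ h₁ hall
    obtain ⟨c, hc⟩ := ae_eq_halfSpace_of_shiftSubset hE'm h₀ h₁ he hsh
    exact ⟨_, ⟨e, c, he, rfl⟩, hE'.symm.trans hc⟩
  · rintro ⟨H, ⟨e, c, he, rfl⟩, hEH⟩
    have hin : Measurable fun x : Rn n => (inner ℝ e x : ℝ) := by fun_prop
    exact (isKMinimizer_halfSpace hK hKstar.measurable he c).congr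
      (measurableSet_le hin measurable_const).nullMeasurableSet hEH.symm
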